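/- **Theorem.** Let $X$ be a Banach space and let $\{L(t,\tau)\}_{t\ge\tau}$ be a linear evolution process on $X$: bounded linear operators with $L(t,\tau)=L(t,s)L(s,\tau)$ for $t\ge s\ge\tau$, $L(t,t)=I$, and $(t,\tau)\mapsto L(t,\tau)\eta$ continuous on $\{t\ge\tau\}$ for every $\eta\in X$. Assume that it has an exponential splitting with bound $M\ge1$, exponents $\gamma>\rho$ in $\mathbb R$ and bounded projections $\{Q(t)\}_{t\in\mathbb R}$. That is, for $t\ge\tau$, $Q(t)L(t,\tau)=L(t,\tau)Q(\tau)$, the restriction $L(t,\tau)\colon Q(\tau)X\to Q(t)X$ is an isomorphism with inverse denoted $L(\tau,t)$, and $$e^{\gamma(t-\tau)}\|L(t,\tau)(I-Q(\tau))\|\le M\quad(t\ge\tau),\qquad e^{\rho(t-\tau)}\|L(t,\tau)Q(\tau)\|\le M\quad(t\le\tau).$$ Put $$|x|_{N(\tau)}=\sup_{t\le\tau}e^{\rho(t-\tau)}\|L(t,\tau)x\|\ \ (x\in Q(\tau)X),\qquad |x|_{S(\tau)}=\sup_{t\ge\tau}e^{\gamma(t-\tau)}\|L(t,\tau)x\|\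 \ (x\in (I-Q(\tau))X).$$ Let $\Gamma$ be an admissible norm on $\mathbb R^2$, i.e. a norm such that $\Gamma(a,\cdot)$ and $\Gamma(\cdot,b)$ are nondecreasing on $[0,\infty)$ for all $a,b\ge0$, and put $\|x\|_\tau=\Gamma\big(|Q(\tau)x|_{N(\tau)},|(I-Q(\tau))x|_{S(\tau)}\big)$ for $x\in X$. Let $f\colon\mathbb R\times X\to X$ be continuous with $f(t,0)=0$ for all $t$, and let $L_1,L_2>0$ be such that for all $t\in\mathbb R$ and $u,v\in X$ $$|Q(t)(f(t,u)-f(t,v))|_{N(t)}\le L_1\|u-v\|_t,\qquad |(I-Q(t))(f(t,u)-f(t,v))|_{S(t)}\le L_2\|u-v\|_t.$$ Let $\{T(t,\tau)\}_{t\ge\tau}$ be an evolution process of maps $X\to X$ (that is, $T(t,t)=I$, $T(t,s)T(s,\tau)=T(t,\tau)$ for $t\ge s\ge\tau$, and $t\mapsto T(t,\tau)\eta$ continuous on $[\tau,\infty)$ for all $\tau,\eta$) with $$T(t,\tau)\eta=L(t,\tau)\eta+\int_\tau^tL(t,s)f(s,T(s,\tau)\eta)\,ds\qquad(t\ge\tau,\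 \eta\in X).$$ Finally, let $\sigma\in(\rho,\gamma)$ satisfy the gap condition $\Gamma\big(\tfrac{L_1}{\sigma-\rho},\tfrac{L_2}{\gamma-\sigma}\big)<1$, and for $t\in\mathbb R$ let $$\mathcal S(t)=\Big\{\eta\in X:\ \sup_{r\ge t}e^{\sigma r}\|T(r,t)\eta\|_r<\infty\Big\}.$$ Then $\{\mathcal S(t)\}_{t\in\mathbb R}$ is positively invariant, i.e. $T(t,\tau)\mathcal S(\tau)\subset\mathcal S(t)$ for $t\ge\tau$. Moreover, there are a constant $$0<\kappa_\Theta<\frac{L_1}{L_2}\,\frac{\gamma-\sigma}{\sigma-\rho}\qquad\text{with}\qquad \gamma-\rho=L_1\Gamma\Big(1,\frac1{\kappa_\Theta}\Big)+L_2\Gamma(\kappa_\Theta,1)$$ and a function $\Theta\colon\mathbb R\times X\to X$ such that, with $P_\Theta(t)u=\Theta(t,u)+(I-Q(t))u$: 1. $\mathcal S(t)=P_\Theta(t)X$ for every $t\in\mathbb R$; 2. $\Theta(t,u)=\Theta(t,(I-Q(t))u)=Q(t)\Theta(t,u)$ and $\Theta(t,0)=0$ for all $t\in\mathbb R$, $u\in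 X$; 3. $|\Theta(t,\eta)-\Theta(t,\tilde\eta)|_{N(t)}\le\kappa_\Theta\,|(I-Q(t))(\eta-\tilde\eta)|_{S(t)}$ for all $t\in\mathbb R$ and $\eta,\tilde\eta\in X$; 4. for all $t\ge\tau$ and $u\in X$, $$\|T(t,\tau)P_\Theta(\tau)u\|_t\le\frac{\Gamma(\kappa_\Theta,1)}{\Gamma(0,1)}\,e^{-(\gamma-L_2\Gamma(\kappa_\Theta,1))(t-\tau)}\,\|P_\Theta(\tau)u\|_\tau .$$ -/

import Mathlib

/-- A linear evolution process on `X`: a family `L t τ` of bounded operators, of which only the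
values with `τ ≤ t` are meaningful. -/
structure IsLinearEvolutionProcess {X : Type*} [NormedAddCommGroup X] [NormedSpace ℝ X]
    (L : ℝ → ℝ → X →L[ℝ] X) : Prop where
  comp : ∀ t s τ : ℝ, τ ≤ s → s ≤ t → L t τ = (L t s).comp (L s τ)
  self : ∀ t : ℝ, L t t = ContinuousLinearMap.id ℝ X
  continuousOn : ∀ η : X, ContinuousOn (fun p : ℝ × ℝ => L p.1 p.2 η) {p | p.2 ≤ p.1}

/-- A (nonlinear) evolution process on `X`: a family `T t τ` of maps, of which only the values with
`τ ≤ t` are meaningful. -/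
structure IsEvolutionProcess {X : Type*} [NormedAddCommGroup X]
    (T : ℝ → ℝ → X → X) : Prop where
  comp : ∀ t s τ : ℝ, τ ≤ s → s ≤ t → ∀ η : X, T t τ η = T t s (T s τ η)
  self : ∀ (t : ℝ) (η : X), T t t η = η
  continuousOn : ∀ (τ : ℝ) (η : X), ContinuousOn (fun t => T t τ η) (Set.Ici τ)

/-- For `t ≤ τ`, the inverse `L(t, τ) : Q(τ)X → Q(t)X` of the restriction
`L(τ, t) : Q(t)X → Q(τ)X`. Its value at `x ∈ Q(τ)X` is the point `y ∈ Q(t)X` with `L(τ, t) y = x`,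
which is unique when that restriction is bijective. -/
noncomputable def backwardMap {X : Type*} [NormedAddCommGroup X] [NormedSpace ℝ X]
    (L : ℝ → ℝ → X →L[ℝ] X) (Q : ℝ → X →L[ℝ] X) (t τ : ℝ) : X → X :=
  Function.invFunOn (L τ t) (Set.range (Q t))

/-- Exponential splitting of a linear evolution process with bound `M`, exponents `γ > ρ` and
projections `Q t`. The field `backward` is the bound `e ^ (ρ (t - τ)) ‖L(t, τ) Q(τ)‖ ≤ M` for
`t ≤ τ`, which also makes the inverses in `bijOn` bounded. -/
structure HasExponentialSplitting {X : Type*} [NormedAddCommGroup X] [NormedSpace ℝ X]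
    (L : ℝ → ℝ → X →L[ℝ] X) (Q : ℝ → X →L[ℝ] X) (M γ ρ : ℝ) : Prop where
  one_le : 1 ≤ M
  lt : ρ < γ
  proj : ∀ t : ℝ, (Q t).comp (Q t) = Q t
  commute : ∀ t τ : ℝ, τ ≤ t → (Q t).comp (L t τ) = (L t τ).comp (Q τ)
  bijOn : ∀ t τ : ℝ, τ ≤ t → Set.BijOn (L t τ) (Set.range (Q τ)) (Set.range (Q t))
  forward : ∀ t τ : ℝ, τ ≤ t →
    Real.exp (γ * (t - τ)) * ‖(L t τ).comp (ContinuousLinearMap.id ℝ X - Q τ)‖ ≤ M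
  backward : ∀ t τ : ℝ, t ≤ τ → ∀ x : X,
    Real.exp (ρ * (t - τ)) * ‖backwardMap L Q t τ (Q τ x)‖ ≤ M * ‖x‖

/-- The norm `|x|_{N(τ)} = sup_{t ≤ τ} e ^ (ρ (t - τ)) ‖L(t, τ) x‖` on `N(τ) = Q(τ)X`. -/
noncomputable def unstableNorm {X : Type*} [NormedAddCommGroup X] [NormedSpace ℝ X]
    (L : ℝ → ℝ → X →L[ℝ] X) (Q : ℝ → X →L[ℝ] X) (ρ τ : ℝ) (x : X) : ℝ :=
  ⨆ t : Set.Iic τ, Real.exp (ρ * ((t : ℝ) - τ)) * ‖backwardMap L Q t τ x‖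

/-- The norm `|x|_{S(τ)} = sup_{t ≥ τ} e ^ (γ (t - τ)) ‖L(t, τ) x‖` on `S(τ) = (I - Q(τ))X`. -/
noncomputable def stableNorm {X : Type*} [NormedAddCommGroup X] [NormedSpace ℝ X]
    (L : ℝ → ℝ → X →L[ℝ] X) (γ τ : ℝ) (x : X) : ℝ :=
  ⨆ t : Set.Ici τ, Real.exp (γ * ((t : ℝ) - τ)) * ‖L t τ x‖

/-- An admissible norm on `ℝ²`: a norm that is nondecreasing in each variable on the closed first
quadrant. All the `p`-norms, `1 ≤ p ≤ ∞`, are admissible. -/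
structure IsAdmissibleNorm (Γ : Seminorm ℝ (ℝ × ℝ)) : Prop where
  definite : ∀ x : ℝ × ℝ, Γ x = 0 → x = 0
  mono_right : ∀ a : ℝ, 0 ≤ a → MonotoneOn (fun b => Γ (a, b)) (Set.Ici 0)
  mono_left : ∀ b : ℝ, 0 ≤ b → MonotoneOn (fun a => Γ (a, b)) (Set.Ici 0)

/-- The moving norm `‖x‖_τ = Γ(|Q(τ)x|_{N(τ)}, |(I - Q(τ))x|_{S(τ)})` on `X`. -/
noncomputable def movingNorm {X : Type*} [NormedAddCommGroup X] [NormedSpace ℝ X]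
    (Γ : Seminorm ℝ (ℝ × ℝ)) (L : ℝ → ℝ → X →L[ℝ] X) (Q : ℝ → X →L[ℝ] X)
    (γ ρ τ : ℝ) (x : X) : ℝ :=
  Γ (unstableNorm L Q ρ τ (Q τ x), stableNorm L γ τ (x - Q τ x))

/-- The set `{η : sup_{r ≥ t} e ^ (σ r) ‖T(r, t) η‖_r < ∞}`. -/
def stableSet {X : Type*} [NormedAddCommGroup X] [NormedSpace ℝ X]
    (Γ : Seminorm ℝ (ℝ × ℝ)) (L : ℝ → ℝ → X →L[ℝ] X) (Q : ℝ → X →L[ℝ] X)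
    (γ ρ σ : ℝ) (T : ℝ → ℝ → X → X) (t : ℝ) : Set X :=
  {η | BddAbove ((fun r => Real.exp (σ * r) * movingNorm Γ L Q γ ρ r (T r t η)) '' Set.Ici t)}

/-! The norms `|·|_N` and `|·|_S` absorb the constant `M`: forwards on the stable subspaces and
backwards on the unstable ones, the linear process satisfies its exponential bounds with constant
one, so sharp constants survive in all estimates.

Existence (Lyapunov–Perron). An orbit bounded by a multiple of `e^(-σt)`, with `ρ < σ < γ`, must
have unstable part `-∫_t^∞ L(t,s)Q(s)f ds`, because its image under `L(t,r)Q(r)` vanishes as `r → ∞`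
(`proj_eq_neg_integral`). Prescribing the stable part `ξ` at time `τ` therefore turns the problem
into a fixed point equation on exponentially weighted paths. Its Lipschitz constant in the weighted
moving norm is `Γ(L₁/(σ-ρ), L₂/(γ-σ)) < 1`, so every `ξ` is the stable part of a point of the stable
set (`exists_mem_stableSet`).

Graph property. Comparing two such orbits shows that the stable set is a Lipschitz graph with slope
`κ₀ = (L₁/L₂)(γ-σ)/(σ-ρ)` (`slopeBound_initial`).

Optimal slope. If `m` is an admissible slope with `L₂Γ(m,1) < γ-σ`, the stable part of a difference
of orbits decays at rate `γ - L₂Γ(m,1)`. Inserting this in the backward integral gives the slope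
`L₁Γ(m,1)/(γ-ρ-L₂Γ(m,1))` (`slopeBound_step`). This is smaller than `m` exactly when `(L₁/m +
L₂)Γ(m,1) < γ-ρ`, which holds from `κ₀` down to the largest root `κ` of the corresponding equation.
Hence `κ` itself is an admissible slope (`slopeBound_of_root`), and the decay estimate is the one
attached to `m = κ`. -/

open MeasureTheory Filter Topology
open scoped BoundedContinuousFunction

/-! ### Strongly continuous families of operators -/

section StrongContinuity

variable {X : Type*} [NormedAddCommGroup X] [NormedSpace ℝ X] [CompleteSpace X]

theorem exists_bound_of_strongly_continuousOn {α : Type*} [TopologicalSpace α]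
    {A : α → X →L[ℝ] X} {K : Set α} (hK : IsCompact K)
    (hA : ∀ x, ContinuousOn (fun a => A a x) K) : ∃ C, 0 ≤ C ∧ ∀ a ∈ K, ‖A a‖ ≤ C := by
  obtain ⟨C, hC⟩ := banach_steinhaus (g := fun a : K => A a) (fun x => by
    obtain ⟨C, hC⟩ := hK.exists_bound_of_continuousOn (hA x)
    exact ⟨C, fun a => hC a a.2⟩)
  exact ⟨max C 0, le_max_right _ _, fun a ha => (hC ⟨a, ha⟩).trans (le_max_left _ _)⟩

/-- Near `(a, x)` write `A p y = A p (y - x) + A p x`: the local uniform bound controls the first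
term and strong continuity the second. -/
theorem continuous_apply_of_strongly_continuous {α : Type*} [TopologicalSpace α]
    [WeaklyLocallyCompactSpace α] {A : α → X →L[ℝ] X} (hA : ∀ x, Continuous fun a => A a x) :
    Continuous fun p : α × X => A p.1 p.2 := by
  rw [continuous_iff_continuousAt]
  rintro ⟨a, x⟩
  obtain ⟨K, hK, hKa⟩ := exists_compact_mem_nhds a
  obtain ⟨C, hC0, hC⟩ := exists_bound_of_strongly_continuousOn hK fun x => (hA x).continuousOn
  have h1 : Tendsto (fun p : α × X => A p.1 (p.2 - x)) (𝓝 (a, x)) (𝓝 0) := by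
    have hx : Tendsto (fun p : α × X => C * ‖p.2 - x‖) (𝓝 (a, x)) (𝓝 0) := by
      have : Continuous fun p : α × X => C * ‖p.2 - x‖ := by fun_prop
      simpa using this.tendsto (a, x)
    refine squeeze_zero_norm' ?_ hx
    filter_upwards [continuous_fst.tendsto (a, x) hKa] with p hp
    exact ((A p.1).le_opNorm _).trans (mul_le_mul_of_nonneg_right (hC _ hp) (norm_nonneg _))
  have h2 : Tendsto (fun p : α × X => A p.1 x) (𝓝 (a, x)) (𝓝 (A a x)) :=
    ((hA x).comp continuous_fst).tendsto (a, x)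
  have h3 := h1.add h2
  simp only [zero_add] at h3
  refine h3.congr fun p => ?_
  simp

end StrongContinuity

/-! ### Continuity of linear processes and of mild solutions -/

namespace IsLinearEvolutionProcess

variable {X : Type*} [NormedAddCommGroup X] [NormedSpace ℝ X]
  {L : ℝ → ℝ → X →L[ℝ] X}

theorem self_apply (hL : IsLinearEvolutionProcess L) (t : ℝ) (x : X) : L t t x = x := by
  rw [hL.self]; rfl

theorem comp_apply (hL : IsLinearEvolutionProcess L) {t s τ : ℝ} (h₁ : τ ≤ s) (h₂ : s ≤ t)
    (x : X) : L t s (L s τ x) = L t τ x := by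
  rw [hL.comp t s τ h₁ h₂]; rfl

variable [CompleteSpace X]

/-- Replacing `t` by `max t τ` extends the process from the half plane `τ ≤ t`, where alone it is
meaningful, to a jointly continuous map on the whole space. -/
theorem continuous_max (hL : IsLinearEvolutionProcess L) :
    Continuous fun p : (ℝ × ℝ) × X => L (max p.1.1 p.1.2) p.1.2 p.2 :=
  continuous_apply_of_strongly_continuous (A := fun p : ℝ × ℝ => L (max p.1 p.2) p.2) fun x =>
    (hL.continuousOn x).comp_continuous
      (f := fun p : ℝ × ℝ => (max p.1 p.2, p.2)) (by fun_prop) fun p => le_max_right p.1 p.2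

theorem exists_bound (hL : IsLinearEvolutionProcess L) (a b : ℝ) :
    ∃ C, 0 ≤ C ∧ ∀ s t, a ≤ s → s ≤ t → t ≤ b → ‖L t s‖ ≤ C := by
  obtain ⟨C, hC0, hC⟩ := exists_bound_of_strongly_continuousOn
    (A := fun p : ℝ × ℝ => L (max p.1 p.2) p.2) (K := Set.Icc a b ×ˢ Set.Icc a b)
    (isCompact_Icc.prod isCompact_Icc) fun x =>
      (hL.continuous_max.comp (by fun_prop : Continuous fun p : ℝ × ℝ => (p, x))).continuousOn
  refine ⟨C, hC0, fun s t h₁ h₂ h₃ => ?_⟩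
  have := hC (t, s) ⟨⟨h₁.trans h₂, h₃⟩, ⟨h₁, h₂.trans h₃⟩⟩
  simpa [max_eq_left h₂] using this

theorem continuousOn_apply (hL : IsLinearEvolutionProcess L) {F : ℝ → X} {a b : ℝ}
    (hF : ContinuousOn F (Set.Icc a b)) : ContinuousOn (fun s => L b s (F s)) (Set.Icc a b) := by
  have h : ContinuousOn (fun s => L (max b s) s (F s)) (Set.Icc a b) :=
    hL.continuous_max.comp_continuousOn (f := fun s => ((b, s), F s))
      ((by fun_prop : Continuous fun s : ℝ => (b, s)).continuousOn.prodMk hF)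
  refine h.congr fun s hs => ?_
  simp [max_eq_left hs.2]

theorem intervalIntegrable_apply (hL : IsLinearEvolutionProcess L) {F : ℝ → X} {a b : ℝ}
    (hab : a ≤ b) (hF : ContinuousOn F (Set.Icc a b)) :
    IntervalIntegrable (fun s => L b s (F s)) volume a b :=
  ContinuousOn.intervalIntegrable_of_Icc hab (hL.continuousOn_apply hF)

/-- The mild solution of an inhomogeneous linear problem with continuous forcing is continuous. -/
theorem continuousOn_mild (hL : IsLinearEvolutionProcess L) {F : ℝ → X} (hF : Continuous F)
    (τ : ℝ) (x : X) :
    ContinuousOn (fun t => L t τ x + ∫ s in τ..t, L t s (F s)) (Set.Ici τ) := by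
  have h₁ : Continuous fun t => L (max t τ) τ x + ∫ s in τ..t, L (max t s) s (F s) := by
    refine Continuous.add (hL.continuous_max.comp
      (by fun_prop : Continuous fun t : ℝ => ((t, τ), x))) ?_
    refine intervalIntegral.continuous_parametric_intervalIntegral_of_continuous
      (f := fun t s => L (max t s) s (F s)) ?_ continuous_id
    exact hL.continuous_max.comp
      (by fun_prop : Continuous fun p : ℝ × ℝ => ((p.1, p.2), F p.2))
  refine h₁.continuousOn.congr fun t (ht : τ ≤ t) => ?_
  simp only [max_eq_left ht]
  congr 1
  refine intervalIntegral.integral_congr fun s hs => ?_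
  rw [Set.uIcc_of_le ht] at hs
  simp [max_eq_left hs.2]

end IsLinearEvolutionProcess

/-! ### Backward operators on the unstable subspaces -/

namespace HasExponentialSplitting

variable {X : Type*} [NormedAddCommGroup X] [NormedSpace ℝ X]
  {L : ℝ → ℝ → X →L[ℝ] X} {Q : ℝ → X →L[ℝ] X} {M γ ρ : ℝ}

theorem proj_apply (hs : HasExponentialSplitting L Q M γ ρ) (t : ℝ) (x : X) :
    Q t (Q t x) = Q t x := DFunLike.congr_fun (hs.proj t) x

theorem commute_apply (hs : HasExponentialSplitting L Q M γ ρ) {t τ : ℝ} (h : τ ≤ t) (x : X) :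
    Q t (L t τ x) = L t τ (Q τ x) := DFunLike.congr_fun (hs.commute t τ h) x

theorem backwardMap_mem (hs : HasExponentialSplitting L Q M γ ρ) {t τ : ℝ} (h : t ≤ τ) (x : X) :
    backwardMap L Q t τ (Q τ x) ∈ Set.range (Q t) :=
  Function.invFunOn_mem ((hs.bijOn τ t h).surjOn ⟨x, rfl⟩)

theorem apply_backwardMap (hs : HasExponentialSplitting L Q M γ ρ) {t τ : ℝ} (h : t ≤ τ) (x : X) :
    L τ t (backwardMap L Q t τ (Q τ x)) = Q τ x :=
  Function.invFunOn_eq ((hs.bijOn τ t h).surjOn ⟨x, rfl⟩)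

/-- Injectivity on the range of `Q t` characterises the inverse; linearity and the cocycle
identities below all follow from this. -/
theorem eq_backwardMap (hs : HasExponentialSplitting L Q M γ ρ) {t τ : ℝ} (h : t ≤ τ) {x y : X}
    (hy : Q t y = y) (hxy : L τ t y = Q τ x) : y = backwardMap L Q t τ (Q τ x) :=
  (hs.bijOn τ t h).injOn ⟨y, hy⟩ (hs.backwardMap_mem h x) (hxy.trans (hs.apply_backwardMap h x).symm)

theorem proj_backwardMap (hs : HasExponentialSplitting L Q M γ ρ) {t τ : ℝ} (h : t ≤ τ) (x : X) :
    Q t (backwardMap L Q t τ (Q τ x)) = backwardMap L Q t τ (Q τ x) := by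
  obtain ⟨y, hy⟩ := hs.backwardMap_mem h x
  rw [← hy, hs.proj_apply]

theorem norm_backwardMap_le (hs : HasExponentialSplitting L Q M γ ρ) {t τ : ℝ} (h : t ≤ τ)
    (x : X) : ‖backwardMap L Q t τ (Q τ x)‖ ≤ M * Real.exp (-(ρ * (t - τ))) * ‖x‖ := by
  have := hs.backward t τ h x
  have h2 := mul_le_mul_of_nonneg_left this (Real.exp_pos (-(ρ * (t - τ)))).le
  rw [← mul_assoc, ← Real.exp_add, neg_add_cancel, Real.exp_zero, one_mul] at h2
  linarith

/-- The operator `L(t, τ) Q(τ)` for `t ≤ τ`. -/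
noncomputable def backwardCLM (hs : HasExponentialSplitting L Q M γ ρ) (t τ : ℝ) : X →L[ℝ] X :=
  if h : t ≤ τ then
    LinearMap.mkContinuous
      { toFun := fun x => backwardMap L Q t τ (Q τ x)
        map_add' := fun x y => by
          refine (hs.eq_backwardMap h ?_ ?_).symm
          · rw [map_add, hs.proj_backwardMap h, hs.proj_backwardMap h]
          · rw [map_add, hs.apply_backwardMap h, hs.apply_backwardMap h, map_add]
        map_smul' := fun c x => by
          refine (hs.eq_backwardMap h ?_ ?_).symm
          · simp [hs.proj_backwardMap h]
          · simp [hs.apply_backwardMap h] }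
      (M * Real.exp (-(ρ * (t - τ)))) (hs.norm_backwardMap_le h)
  else 0

theorem backwardCLM_apply (hs : HasExponentialSplitting L Q M γ ρ) {t τ : ℝ} (h : t ≤ τ) (x : X) :
    hs.backwardCLM t τ x = backwardMap L Q t τ (Q τ x) := by
  simp [backwardCLM, h]

theorem proj_backwardCLM (hs : HasExponentialSplitting L Q M γ ρ) {t τ : ℝ} (h : t ≤ τ) (x : X) :
    Q t (hs.backwardCLM t τ x) = hs.backwardCLM t τ x := by
  rw [hs.backwardCLM_apply h, hs.proj_backwardMap h]

theorem apply_backwardCLM (hs : HasExponentialSplitting L Q M γ ρ) {t τ : ℝ} (h : t ≤ τ) (x : X) :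
    L τ t (hs.backwardCLM t τ x) = Q τ x := by
  rw [hs.backwardCLM_apply h, hs.apply_backwardMap h]

theorem eq_backwardCLM (hs : HasExponentialSplitting L Q M γ ρ) {t τ : ℝ} (h : t ≤ τ) {x y : X}
    (hy : Q t y = y) (hxy : L τ t y = Q τ x) : y = hs.backwardCLM t τ x := by
  rw [hs.backwardCLM_apply h, ← hs.eq_backwardMap h hy hxy]

theorem backwardCLM_proj (hs : HasExponentialSplitting L Q M γ ρ) {t τ : ℝ} (h : t ≤ τ) (x : X) :
    hs.backwardCLM t τ (Q τ x) = hs.backwardCLM t τ x := by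
  rw [hs.backwardCLM_apply h, hs.backwardCLM_apply h, hs.proj_apply]

theorem backwardCLM_self (hL : IsLinearEvolutionProcess L)
    (hs : HasExponentialSplitting L Q M γ ρ) (t : ℝ) (x : X) : hs.backwardCLM t t x = Q t x :=
  (hs.eq_backwardCLM le_rfl (hs.proj_apply t x) (hL.self_apply t _)).symm

theorem backwardCLM_forward (hL : IsLinearEvolutionProcess L)
    (hs : HasExponentialSplitting L Q M γ ρ) {t s r : ℝ} (h₁ : t ≤ s) (h₂ : s ≤ r) (x : X) :
    hs.backwardCLM t r (L r s x) = hs.backwardCLM t s x := by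
  refine (hs.eq_backwardCLM (h₁.trans h₂) (hs.proj_backwardCLM h₁ x) ?_).symm
  rw [← hL.comp_apply h₁ h₂, hs.apply_backwardCLM h₁, hs.commute_apply h₂]

theorem forward_backwardCLM (hL : IsLinearEvolutionProcess L)
    (hs : HasExponentialSplitting L Q M γ ρ) {t s r : ℝ} (h₁ : t ≤ s) (h₂ : s ≤ r) (x : X) :
    L s t (hs.backwardCLM t r x) = hs.backwardCLM s r x := by
  refine hs.eq_backwardCLM h₂ ?_ ?_
  · rw [hs.commute_apply h₁, hs.proj_backwardCLM (h₁.trans h₂)]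
  · rw [hL.comp_apply h₁ h₂, hs.apply_backwardCLM (h₁.trans h₂)]

theorem forward_backwardCLM' (hL : IsLinearEvolutionProcess L)
    (hs : HasExponentialSplitting L Q M γ ρ) {t s r : ℝ} (h₁ : t ≤ s) (h₂ : s ≤ r) (x : X) :
    L r t (hs.backwardCLM t s x) = Q r (L r s x) := by
  rw [← hL.comp_apply h₁ h₂, hs.apply_backwardCLM h₁, hs.commute_apply h₂]

theorem backwardCLM_comp (hL : IsLinearEvolutionProcess L)
    (hs : HasExponentialSplitting L Q M γ ρ) {t s r : ℝ} (h₁ : t ≤ s) (h₂ : s ≤ r) (x : X) :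
    hs.backwardCLM t s (hs.backwardCLM s r x) = hs.backwardCLM t r x := by
  rw [← hs.forward_backwardCLM hL h₁ h₂, hs.backwardCLM_forward hL le_rfl h₁,
    hs.backwardCLM_self hL, hs.proj_backwardCLM (h₁.trans h₂)]

/-- On `[t, s + 1]` the operator `L(t,r)Q(r)` is the fixed operator `L(t,s+1)Q(s+1)` composed with
`L(s+1,r)`, so continuity in `r` reduces to the forward process. -/
theorem continuousOn_backwardCLM [CompleteSpace X] (hL : IsLinearEvolutionProcess L)
    (hs : HasExponentialSplitting L Q M γ ρ) {F : ℝ → X} {t : ℝ}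
    (hF : ContinuousOn F (Set.Ici t)) :
    ContinuousOn (fun s => hs.backwardCLM t s (F s)) (Set.Ici t) := by
  intro s (hts : t ≤ s)
  have h : ContinuousOn (fun s => hs.backwardCLM t s (F s)) (Set.Icc t (s + 1)) := by
    refine ((hs.backwardCLM t (s + 1)).continuous.comp_continuousOn
      (hL.continuousOn_apply (hF.mono Set.Icc_subset_Ici_self))).congr fun r hr => ?_
    exact (hs.backwardCLM_forward hL hr.1 hr.2 _).symm
  refine (h s ⟨hts, by linarith⟩).mono_of_mem_nhdsWithin ?_
  rw [← Set.Ici_inter_Iic]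
  exact inter_mem_nhdsWithin _ (Iic_mem_nhds (by linarith))

/-! ### The norms on the two subspaces -/


/-- An unbounded real supremum is `0` by convention, so lower bounds for the norm require this
boundedness. -/
theorem bddAbove_unstable (hs : HasExponentialSplitting L Q M γ ρ) (τ : ℝ) (x : X) :
    BddAbove (Set.range fun t : Set.Iic τ =>
      Real.exp (ρ * ((t : ℝ) - τ)) * ‖backwardMap L Q t τ (Q τ x)‖) := by
  refine ⟨M * ‖x‖, ?_⟩
  rintro _ ⟨t, rfl⟩
  exact hs.backward t τ t.2 x

theorem unstableNorm_le (hs : HasExponentialSplitting L Q M γ ρ) {τ : ℝ} {x : X} {C : ℝ}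
    (h : ∀ t ≤ τ, Real.exp (ρ * (t - τ)) * ‖hs.backwardCLM t τ x‖ ≤ C) :
    unstableNorm L Q ρ τ (Q τ x) ≤ C := by
  have : Nonempty (Set.Iic τ) := ⟨⟨τ, Set.self_mem_Iic⟩⟩
  refine ciSup_le fun t => ?_
  rw [← hs.backwardCLM_apply t.2]
  exact h t t.2

theorem le_unstableNorm (hs : HasExponentialSplitting L Q M γ ρ) {t τ : ℝ} (h : t ≤ τ) (x : X) :
    Real.exp (ρ * (t - τ)) * ‖hs.backwardCLM t τ x‖ ≤ unstableNorm L Q ρ τ (Q τ x) := by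
  rw [hs.backwardCLM_apply h]
  exact le_ciSup (hs.bddAbove_unstable τ x) ⟨t, h⟩

theorem norm_backwardCLM_le (hs : HasExponentialSplitting L Q M γ ρ) {t τ : ℝ} (h : t ≤ τ)
    (x : X) : ‖hs.backwardCLM t τ x‖ ≤
      Real.exp (ρ * (τ - t)) * unstableNorm L Q ρ τ (Q τ x) := by
  have := mul_le_mul_of_nonneg_left (hs.le_unstableNorm h x) (Real.exp_pos (ρ * (τ - t))).le
  rwa [← mul_assoc, ← Real.exp_add, show ρ * (τ - t) + ρ * (t - τ) = 0 by ring, Real.exp_zero,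
    one_mul] at this

theorem unstableNorm_nonneg (τ : ℝ) (x : X) : 0 ≤ unstableNorm L Q ρ τ x :=
  Real.iSup_nonneg fun _ => by positivity

theorem unstableNorm_le_norm (hs : HasExponentialSplitting L Q M γ ρ) (τ : ℝ) (x : X) :
    unstableNorm L Q ρ τ (Q τ x) ≤ M * ‖x‖ :=
  hs.unstableNorm_le fun t h => by
    rw [hs.backwardCLM_apply h]; exact hs.backward t τ h x

theorem forward_le (hs : HasExponentialSplitting L Q M γ ρ) {t τ : ℝ} (h : τ ≤ t) (x : X) :
    Real.exp (γ * (t - τ)) * ‖L t τ (x - Q τ x)‖ ≤ M * ‖x‖ := by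
  have h1 : ‖L t τ (x - Q τ x)‖ ≤ ‖(L t τ).comp (ContinuousLinearMap.id ℝ X - Q τ)‖ * ‖x‖ :=
    ((L t τ).comp (ContinuousLinearMap.id ℝ X - Q τ)).le_opNorm x
  calc _ ≤ Real.exp (γ * (t - τ)) *
        (‖(L t τ).comp (ContinuousLinearMap.id ℝ X - Q τ)‖ * ‖x‖) := by gcongr
    _ = (Real.exp (γ * (t - τ)) * ‖(L t τ).comp (ContinuousLinearMap.id ℝ X - Q τ)‖) * ‖x‖ := by
      ring
    _ ≤ M * ‖x‖ := by gcongr; exact hs.forward t τ h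

theorem stableNorm_le {τ : ℝ} {x : X} {C : ℝ}
    (h : ∀ t, τ ≤ t → Real.exp (γ * (t - τ)) * ‖L t τ x‖ ≤ C) : stableNorm L γ τ x ≤ C := by
  have : Nonempty (Set.Ici τ) := ⟨⟨τ, Set.self_mem_Ici⟩⟩
  exact ciSup_le fun t => h t t.2

theorem le_stableNorm (hs : HasExponentialSplitting L Q M γ ρ) {t τ : ℝ} (h : τ ≤ t) (x : X) :
    Real.exp (γ * (t - τ)) * ‖L t τ (x - Q τ x)‖ ≤ stableNorm L γ τ (x - Q τ x) := by
  refine le_ciSup (f := fun t : Set.Ici τ => Real.exp (γ * ((t : ℝ) - τ)) * ‖L t τ (x - Q τ x)‖)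
    ⟨M * ‖x‖, ?_⟩ ⟨t, h⟩
  rintro _ ⟨t, rfl⟩
  exact hs.forward_le t.2 x

theorem norm_forward_le (hs : HasExponentialSplitting L Q M γ ρ) {t τ : ℝ} (h : τ ≤ t) (x : X) :
    ‖L t τ (x - Q τ x)‖ ≤ Real.exp (-γ * (t - τ)) * stableNorm L γ τ (x - Q τ x) := by
  have := mul_le_mul_of_nonneg_left (hs.le_stableNorm h x) (Real.exp_pos (-γ * (t - τ))).le
  rwa [← mul_assoc, ← Real.exp_add, show -γ * (t - τ) + γ * (t - τ) = 0 by ring, Real.exp_zero,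
    one_mul] at this

theorem stableNorm_nonneg (τ : ℝ) (x : X) : 0 ≤ stableNorm L γ τ x :=
  Real.iSup_nonneg fun _ => by positivity

theorem stableNorm_le_norm (hs : HasExponentialSplitting L Q M γ ρ) (τ : ℝ) (x : X) :
    stableNorm L γ τ (x - Q τ x) ≤ M * ‖x‖ :=
  stableNorm_le fun _ h => hs.forward_le h x

theorem norm_le_add (hL : IsLinearEvolutionProcess L)
    (hs : HasExponentialSplitting L Q M γ ρ) (τ : ℝ) (x : X) :
    ‖x‖ ≤ unstableNorm L Q ρ τ (Q τ x) + stableNorm L γ τ (x - Q τ x) := by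
  have h1 := hs.le_unstableNorm (le_refl τ) x
  have h2 := hs.le_stableNorm (le_refl τ) x
  rw [hs.backwardCLM_self hL] at h1
  rw [hL.self_apply] at h2
  simp only [sub_self, mul_zero, Real.exp_zero, one_mul] at h1 h2
  calc ‖x‖ = ‖Q τ x + (x - Q τ x)‖ := by simp
    _ ≤ _ := (norm_add_le _ _).trans (add_le_add h1 h2)

end HasExponentialSplitting

/-! ### Admissible norms on the plane -/

namespace IsAdmissibleNorm

variable {Γ : Seminorm ℝ (ℝ × ℝ)}

theorem mono (hΓ : IsAdmissibleNorm Γ) {a b a' b' : ℝ} (ha : 0 ≤ a) (hb : 0 ≤ b) (haa : a ≤ a')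
    (hbb : b ≤ b') : Γ (a, b) ≤ Γ (a', b') :=
  (hΓ.mono_left b hb ha (ha.trans haa) haa).trans
    (hΓ.mono_right a' (ha.trans haa) hb (hb.trans hbb) hbb)

theorem pos (hΓ : IsAdmissibleNorm Γ) {x : ℝ × ℝ} (hx : x ≠ 0) : 0 < Γ x :=
  lt_of_le_of_ne (apply_nonneg Γ x) fun h => hx (hΓ.definite x h.symm)

theorem map_mul {c : ℝ} (hc : 0 ≤ c) (a b : ℝ) : Γ (c * a, c * b) = c * Γ (a, b) := by
  have := map_smul_eq_mul Γ c (a, b)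
  rwa [Real.norm_of_nonneg hc] at this

theorem add_le (hΓ : IsAdmissibleNorm Γ) : ∃ C, 0 < C ∧ ∀ a b : ℝ, 0 ≤ a → 0 ≤ b →
    a + b ≤ C * Γ (a, b) := by
  have h1 : 0 < Γ (1, 0) := hΓ.pos (by simp)
  have h2 : 0 < Γ (0, 1) := hΓ.pos (by simp)
  refine ⟨(Γ (1, 0))⁻¹ + (Γ (0, 1))⁻¹, by positivity, fun a b ha hb => ?_⟩
  have h3 : a * Γ (1, 0) ≤ Γ (a, b) := by
    rw [← map_mul ha]; simpa using hΓ.mono ha le_rfl le_rfl hb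
  have h4 : b * Γ (0, 1) ≤ Γ (a, b) := by
    rw [← map_mul hb]; simpa using hΓ.mono le_rfl hb ha le_rfl
  rw [add_mul]
  refine add_le_add ?_ ?_
  · rw [inv_mul_eq_div, le_div_iff₀ h1]; exact h3
  · rw [inv_mul_eq_div, le_div_iff₀ h2]; exact h4

end IsAdmissibleNorm

/-! ### Comparison of moving and ambient norms, uniformly in time -/

section MovingNorm

variable {X : Type*} [NormedAddCommGroup X] [NormedSpace ℝ X]
  {L : ℝ → ℝ → X →L[ℝ] X} {Q : ℝ → X →L[ℝ] X} {M γ ρ : ℝ} {Γ : Seminorm ℝ (ℝ × ℝ)}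

theorem exists_norm_le_movingNorm (hL : IsLinearEvolutionProcess L)
    (hs : HasExponentialSplitting L Q M γ ρ) (hΓ : IsAdmissibleNorm Γ) :
    ∃ C, 0 < C ∧ ∀ t x, ‖x‖ ≤ C * movingNorm Γ L Q γ ρ t x := by
  obtain ⟨C, hC0, hC⟩ := hΓ.add_le
  exact ⟨C, hC0, fun t x => (hs.norm_le_add hL t x).trans
    (hC _ _ (HasExponentialSplitting.unstableNorm_nonneg _ _)
      (HasExponentialSplitting.stableNorm_nonneg _ _))⟩

theorem exists_movingNorm_le_norm (hs : HasExponentialSplitting L Q M γ ρ)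
    (hΓ : IsAdmissibleNorm Γ) : ∃ C, 0 < C ∧ ∀ t x, movingNorm Γ L Q γ ρ t x ≤ C * ‖x‖ := by
  have hM := zero_lt_one.trans_le hs.one_le
  refine ⟨M * Γ (1, 1), mul_pos hM (hΓ.pos (by simp)), fun t x => ?_⟩
  calc movingNorm Γ L Q γ ρ t x ≤ Γ (M * ‖x‖ * 1, M * ‖x‖ * 1) :=
        hΓ.mono (HasExponentialSplitting.unstableNorm_nonneg _ _)
          (HasExponentialSplitting.stableNorm_nonneg _ _)
          (by simpa using hs.unstableNorm_le_norm t x) (by simpa using hs.stableNorm_le_norm t x)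
    _ = M * Γ (1, 1) * ‖x‖ := by
      rw [IsAdmissibleNorm.map_mul (mul_nonneg hM.le (norm_nonneg x))]; ring

end MovingNorm

/-! ### Exponential estimates for mild solutions -/

theorem integral_exp_mul_exp {γ μ : ℝ} (h : μ < γ) (τ t : ℝ) :
    ∫ s in τ..t, Real.exp (-γ * (t - s)) * Real.exp (-μ * (s - τ)) =
      (Real.exp (-μ * (t - τ)) - Real.exp (-γ * (t - τ))) / (γ - μ) := by
  have h0 : γ - μ ≠ 0 := (sub_pos.2 h).ne'
  have hd : ∀ s ∈ Set.uIcc τ t, HasDerivAt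
      (fun s => Real.exp (-γ * (t - s)) * Real.exp (-μ * (s - τ)) / (γ - μ))
      (Real.exp (-γ * (t - s)) * Real.exp (-μ * (s - τ))) s := fun s _ => by
    have h1 : HasDerivAt (fun s => Real.exp (-γ * (t - s)))
        (Real.exp (-γ * (t - s)) * (-γ * (0 - 1))) s :=
      (((hasDerivAt_const s t).sub (hasDerivAt_id s)).const_mul (-γ)).exp
    have h2 : HasDerivAt (fun s => Real.exp (-μ * (s - τ)))
        (Real.exp (-μ * (s - τ)) * (-μ * 1)) s :=
      (((hasDerivAt_id s).sub_const τ).const_mul (-μ)).exp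
    refine ((h1.mul h2).div_const (γ - μ)).congr_deriv ?_
    field_simp
    ring
  rw [intervalIntegral.integral_eq_sub_of_hasDerivAt hd
    (Continuous.intervalIntegrable (by fun_prop) _ _)]
  simp
  ring

namespace HasExponentialSplitting

variable {X : Type*} [NormedAddCommGroup X] [NormedSpace ℝ X]
  {L : ℝ → ℝ → X →L[ℝ] X} {Q : ℝ → X →L[ℝ] X} {M γ ρ : ℝ} {F : ℝ → X} {A μ t : ℝ}

theorem norm_backwardCLM_le_exp (hs : HasExponentialSplitting L Q M γ ρ)
    (hFA : ∀ s, t ≤ s → unstableNorm L Q ρ s (Q s (F s)) ≤ A * Real.exp (-μ * (s - t)))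
    {r s : ℝ} (hrt : r ≤ t) (hts : t ≤ s) :
    ‖hs.backwardCLM r s (F s)‖ ≤
      Real.exp (ρ * (t - r)) * A * Real.exp ((μ - ρ) * t) * Real.exp ((ρ - μ) * s) := by
  refine (hs.norm_backwardCLM_le (hrt.trans hts) _).trans ?_
  refine (mul_le_mul_of_nonneg_left (hFA s hts) (Real.exp_pos _).le).trans_eq ?_
  rw [mul_left_comm, ← Real.exp_add, mul_comm (Real.exp _) A, mul_assoc, mul_assoc,
    ← Real.exp_add, ← Real.exp_add]
  ring_nf

variable [CompleteSpace X]

/-- Each `r ≥ t` in the supremum is tested separately: `L(r,t)(I - Q(t))` turns the variation of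
constants formula at `t` into one at `r`, and the adapted norm bounds every term without a factor
`M`. -/
theorem stableNorm_mild_le (hL : IsLinearEvolutionProcess L)
    (hs : HasExponentialSplitting L Q M γ ρ) {τ : ℝ} (ht : τ ≤ t)
    (hF : ContinuousOn F (Set.Icc τ t)) {g : ℝ → ℝ} (hg : Continuous g)
    (hFg : ∀ s ∈ Set.Icc τ t, stableNorm L γ s (F s - Q s (F s)) ≤ g s) (x : X) {y : X}
    (hy : y = L t τ x + ∫ s in τ..t, L t s (F s)) :
    stableNorm L γ t (y - Q t y) ≤ Real.exp (-γ * (t - τ)) * stableNorm L γ τ (x - Q τ x) +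
      ∫ s in τ..t, Real.exp (-γ * (t - s)) * g s := by
  refine stableNorm_le fun r hr => ?_
  let P : X →L[ℝ] X := (L r t).comp (ContinuousLinearMap.id ℝ X - Q t)
  have hP : ∀ s ≤ t, ∀ z, P (L t s z) = L r s (z - Q s z) := fun s hst z => by
    simp only [P, ContinuousLinearMap.comp_apply, sub_apply,
      ContinuousLinearMap.id_apply]
    rw [hs.commute_apply hst, ← map_sub, hL.comp_apply hst hr]
  have h1 : L r t (y - Q t y) = L r τ (x - Q τ x) + ∫ s in τ..t, L r s (F s - Q s (F s)) := by
    change P y = _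
    rw [hy, map_add, hP τ ht,
      ← ContinuousLinearMap.intervalIntegral_comp_comm _ (hL.intervalIntegrable_apply ht hF)]
    congr 1
    refine intervalIntegral.integral_congr fun s hs' => ?_
    rw [Set.uIcc_of_le ht] at hs'
    exact hP s hs'.2 _
  have h2 : ‖∫ s in τ..t, L r s (F s - Q s (F s))‖ ≤
      ∫ s in τ..t, Real.exp (-γ * (r - s)) * g s := by
    refine intervalIntegral.norm_integral_le_of_norm_le ht (ae_of_all _ fun s hs' => ?_)
      (Continuous.intervalIntegrable (by fun_prop) _ _)
    have hsI := Set.Ioc_subset_Icc_self hs'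
    exact (hs.norm_forward_le (hsI.2.trans hr) _).trans
      (mul_le_mul_of_nonneg_left (hFg s hsI) (Real.exp_pos _).le)
  have h3 : ∫ s in τ..t, Real.exp (-γ * (t - s)) * g s =
      Real.exp (γ * (r - t)) * ∫ s in τ..t, Real.exp (-γ * (r - s)) * g s := by
    rw [← intervalIntegral.integral_const_mul]
    congr 1
    ext s
    rw [← mul_assoc, ← Real.exp_add]
    ring_nf
  have h4 : Real.exp (-γ * (t - τ)) =
      Real.exp (γ * (r - t)) * Real.exp (-γ * (r - τ)) := by
    rw [← Real.exp_add]; ring_nf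
  rw [h1, h3, h4, mul_assoc, ← mul_add]
  refine mul_le_mul_of_nonneg_left ((norm_add_le _ _).trans ?_) (Real.exp_pos _).le
  exact add_le_add (hs.norm_forward_le (ht.trans hr) _) h2

/-- Two rates are allowed at once so that a sharp leading term and a shrinking error of rate `σ` can
be tracked together in the later iteration. -/
theorem stableNorm_mild_le_exp (hL : IsLinearEvolutionProcess L)
    (hs : HasExponentialSplitting L Q M γ ρ) {τ : ℝ} (ht : τ ≤ t)
    (hF : ContinuousOn F (Set.Icc τ t)) {E σ : ℝ} (hμ : μ < γ) (hσ : σ < γ)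
    (hFg : ∀ s ∈ Set.Icc τ t, stableNorm L γ s (F s - Q s (F s)) ≤
      A * Real.exp (-μ * (s - τ)) + E * Real.exp (-σ * (s - τ))) (x : X) {y : X}
    (hy : y = L t τ x + ∫ s in τ..t, L t s (F s)) :
    stableNorm L γ t (y - Q t y) ≤ Real.exp (-γ * (t - τ)) * stableNorm L γ τ (x - Q τ x) +
      A * ((Real.exp (-μ * (t - τ)) - Real.exp (-γ * (t - τ))) / (γ - μ)) +
      E * ((Real.exp (-σ * (t - τ)) - Real.exp (-γ * (t - τ))) / (γ - σ)) := by
  have := hs.stableNorm_mild_le hL ht hF (by fun_prop) hFg x hy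
  rw [add_assoc, ← integral_exp_mul_exp hμ, ← integral_exp_mul_exp hσ,
    ← intervalIntegral.integral_const_mul, ← intervalIntegral.integral_const_mul,
    ← intervalIntegral.integral_add (Continuous.intervalIntegrable (by fun_prop) _ _)
      (Continuous.intervalIntegrable (by fun_prop) _ _)]
  refine this.trans_eq ?_
  congr 2
  ext s
  ring

theorem integrableOn_backwardCLM (hL : IsLinearEvolutionProcess L)
    (hs : HasExponentialSplitting L Q M γ ρ) (hF : ContinuousOn F (Set.Ici t)) (hμ : ρ < μ)
    (hFA : ∀ s, t ≤ s → unstableNorm L Q ρ s (Q s (F s)) ≤ A * Real.exp (-μ * (s - t))) :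
    IntegrableOn (fun s => hs.backwardCLM t s (F s)) (Set.Ioi t) := by
  refine Integrable.mono' ((integrableOn_exp_mul_Ioi (sub_neg.2 hμ) t).const_mul
      (Real.exp (ρ * (t - t)) * A * Real.exp ((μ - ρ) * t)))
    (((hs.continuousOn_backwardCLM hL hF).mono
      Set.Ioi_subset_Ici_self).aestronglyMeasurable measurableSet_Ioi) ?_
  exact (ae_restrict_mem measurableSet_Ioi).mono fun s hts =>
    hs.norm_backwardCLM_le_exp hFA le_rfl (le_of_lt hts)

theorem unstableNorm_le_of_eq_integral (hL : IsLinearEvolutionProcess L)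
    (hs : HasExponentialSplitting L Q M γ ρ) (hF : ContinuousOn F (Set.Ici t)) (hμ : ρ < μ)
    (hFA : ∀ s, t ≤ s → unstableNorm L Q ρ s (Q s (F s)) ≤ A * Real.exp (-μ * (s - t)))
    {x : X} (hx : Q t x = -∫ s in Set.Ioi t, hs.backwardCLM t s (F s)) :
    unstableNorm L Q ρ t (Q t x) ≤ A / (μ - ρ) := by
  refine hs.unstableNorm_le fun r hr => ?_
  -- The backward integral based at `t` is carried to any earlier `r` by the cocycle property; the
  -- resulting factors in `r` cancel the weight of the supremum.
  have h1 : hs.backwardCLM r t x = -∫ s in Set.Ioi t, hs.backwardCLM r s (F s) := by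
    rw [← hs.backwardCLM_proj hr, hx, map_neg, ← ContinuousLinearMap.integral_comp_comm _
      (hs.integrableOn_backwardCLM hL hF hμ hFA)]
    congr 1
    exact setIntegral_congr_fun measurableSet_Ioi fun s hts =>
      hs.backwardCLM_comp hL hr (le_of_lt hts) _
  have h2 : ‖∫ s in Set.Ioi t, hs.backwardCLM r s (F s)‖ ≤ ∫ s in Set.Ioi t,
      Real.exp (ρ * (t - r)) * A * Real.exp ((μ - ρ) * t) * Real.exp ((ρ - μ) * s) :=
    norm_integral_le_of_norm_le ((integrableOn_exp_mul_Ioi (sub_neg.2 hμ) t).const_mul _)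
      ((ae_restrict_mem measurableSet_Ioi).mono fun s hts =>
        hs.norm_backwardCLM_le_exp hFA hr (le_of_lt hts))
  rw [integral_const_mul, integral_exp_mul_Ioi (sub_neg.2 hμ)] at h2
  rw [h1, norm_neg]
  refine (mul_le_mul_of_nonneg_left h2 (Real.exp_pos _).le).trans_eq ?_
  have h3 : Real.exp (ρ * (r - t)) * Real.exp (ρ * (t - r)) = 1 := by
    rw [← Real.exp_add]; ring_nf; simp
  have h4 : Real.exp ((μ - ρ) * t) * Real.exp ((ρ - μ) * t) = 1 := by
    rw [← Real.exp_add]; ring_nf; simp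
  have h5 : μ - ρ ≠ 0 := (sub_pos.2 hμ).ne'
  have h6 : -Real.exp ((ρ - μ) * t) / (ρ - μ) = Real.exp ((ρ - μ) * t) / (μ - ρ) := by
    rw [← neg_sub μ ρ, neg_div_neg_eq]
  rw [h6]
  calc _ = (Real.exp (ρ * (r - t)) * Real.exp (ρ * (t - r))) *
        (Real.exp ((μ - ρ) * t) * Real.exp ((ρ - μ) * t)) * A / (μ - ρ) := by ring
    _ = A / (μ - ρ) := by rw [h3, h4]; ring

/-- A mild solution that does not grow too fast has its unstable part given by the backward
integral. -/
theorem proj_eq_neg_integral (hL : IsLinearEvolutionProcess L)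
    (hs : HasExponentialSplitting L Q M γ ρ) (hF : ContinuousOn F (Set.Ici t)) (hμ : ρ < μ)
    (hFA : ∀ s, t ≤ s → unstableNorm L Q ρ s (Q s (F s)) ≤ A * Real.exp (-μ * (s - t)))
    {x : X} {W : ℝ → X} (hW : ∀ r, t ≤ r → W r = L r t x + ∫ s in t..r, L r s (F s))
    {C : ℝ} (hWC : ∀ r, t ≤ r → ‖W r‖ ≤ C * Real.exp (-μ * r)) :
    Q t x = -∫ s in Set.Ioi t, hs.backwardCLM t s (F s) := by
  -- Pulling `W r` back to time `t` isolates `Q t x`; the left side tends to `0` because `ρ < μ`.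
  have h1 : ∀ r, t ≤ r → hs.backwardCLM t r (W r) =
      Q t x + ∫ s in t..r, hs.backwardCLM t s (F s) := fun r hr => by
    rw [hW r hr, map_add, hs.backwardCLM_forward hL le_rfl hr, hs.backwardCLM_self hL,
      ← ContinuousLinearMap.intervalIntegral_comp_comm _
        (hL.intervalIntegrable_apply hr (hF.mono Set.Icc_subset_Ici_self))]
    congr 1
    refine intervalIntegral.integral_congr fun s hs' => ?_
    rw [Set.uIcc_of_le hr] at hs'
    exact hs.backwardCLM_forward hL hs'.1 hs'.2 _
  have h2 : Tendsto (fun r => hs.backwardCLM t r (W r)) atTop (𝓝 0) := by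
    have h3 : Tendsto (fun r => M * C * Real.exp (-(ρ * t)) * Real.exp ((ρ - μ) * r)) atTop
        (𝓝 0) := by
      rw [← mul_zero (M * C * Real.exp (-(ρ * t)))]
      exact (Real.tendsto_exp_atBot.comp
        (tendsto_id.const_mul_atTop_of_neg (sub_neg.2 hμ))).const_mul _
    refine squeeze_zero_norm' ?_ h3
    filter_upwards [eventually_ge_atTop t] with r hr
    rw [hs.backwardCLM_apply hr]
    refine (hs.norm_backwardMap_le hr _).trans ?_
    have hM := zero_le_one.trans hs.one_le
    refine (mul_le_mul_of_nonneg_left (hWC r hr) (by positivity)).trans_eq ?_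
    have : Real.exp (-(ρ * (t - r))) * Real.exp (-μ * r) =
        Real.exp (-(ρ * t)) * Real.exp ((ρ - μ) * r) := by
      rw [← Real.exp_add, ← Real.exp_add]; ring_nf
    linear_combination (M * C) * this
  have h4 : Tendsto (fun r => Q t x + ∫ s in t..r, hs.backwardCLM t s (F s)) atTop
      (𝓝 (Q t x + ∫ s in Set.Ioi t, hs.backwardCLM t s (F s))) :=
    (intervalIntegral_tendsto_integral_Ioi t (hs.integrableOn_backwardCLM hL hF hμ hFA)
      tendsto_id).const_add _
  refine eq_neg_of_add_eq_zero_left (tendsto_nhds_unique h4 (h2.congr' ?_))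
  filter_upwards [eventually_ge_atTop t] with r hr using h1 r hr

/-- The mild solution started from `ξ` in the stable subspace, corrected by the backward integral,
has its unstable part given by the backward integral at every time. -/
theorem proj_mild_eq_neg_integral (hL : IsLinearEvolutionProcess L)
    (hs : HasExponentialSplitting L Q M γ ρ) {τ : ℝ} (hτt : τ ≤ t)
    (hF : ContinuousOn F (Set.Ici τ)) (hμ : ρ < μ)
    (hFA : ∀ s, τ ≤ s → unstableNorm L Q ρ s (Q s (F s)) ≤ A * Real.exp (-μ * (s - τ)))
    {ξ x y : X} (hξ : Q τ ξ = 0)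
    (hx : x = ξ - ∫ s in Set.Ioi τ, hs.backwardCLM τ s (F s))
    (hy : y = L t τ x + ∫ s in τ..t, L t s (F s)) :
    Q t y = -∫ s in Set.Ioi t, hs.backwardCLM t s (F s) := by
  have hI := hs.integrableOn_backwardCLM hL hF hμ hFA
  -- Split at `t`: for `s ≤ t` going back to `τ` and forward again gives `Q(t)L(t,s)`, which cancels
  -- against the Duhamel term; for `s > t` a shorter backward step remains.
  have h1 : L t τ (∫ s in Set.Ioi τ, hs.backwardCLM τ s (F s)) =
      (∫ s in τ..t, Q t (L t s (F s))) + ∫ s in Set.Ioi t, hs.backwardCLM t s (F s) := by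
    have hI' := (L t τ).integrable_comp hI
    rw [← ContinuousLinearMap.integral_comp_comm _ hI, intervalIntegral.integral_of_le hτt,
      ← Set.Ioc_union_Ioi_eq_Ioi hτt, setIntegral_union (Set.Ioc_disjoint_Ioi le_rfl)
        measurableSet_Ioi (IntegrableOn.mono_set hI' Set.Ioc_subset_Ioi_self)
        (IntegrableOn.mono_set hI' (Set.Ioi_subset_Ioi hτt))]
    congr 1
    · exact setIntegral_congr_fun measurableSet_Ioc fun s hs' =>
        hs.forward_backwardCLM' hL hs'.1.le hs'.2 _
    · exact setIntegral_congr_fun measurableSet_Ioi fun s hts =>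
        hs.forward_backwardCLM hL hτt (le_of_lt hts) _
  have h2 : Q τ (∫ s in Set.Ioi τ, hs.backwardCLM τ s (F s)) =
      ∫ s in Set.Ioi τ, hs.backwardCLM τ s (F s) := by
    rw [← ContinuousLinearMap.integral_comp_comm _ hI]
    exact setIntegral_congr_fun measurableSet_Ioi fun s hts => hs.proj_backwardCLM (le_of_lt hts) _
  rw [hy, map_add, hs.commute_apply hτt, hx, map_sub, hξ, h2, zero_sub, map_neg, h1,
    ← ContinuousLinearMap.intervalIntegral_comp_comm _
      (hL.intervalIntegrable_apply hτt (hF.mono Set.Icc_subset_Ici_self))]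
  abel

end HasExponentialSplitting

/-! ### Uniqueness of mild solutions -/

section MildUniqueness

variable {X : Type*} [NormedAddCommGroup X] [NormedSpace ℝ X] [CompleteSpace X]
  {L : ℝ → ℝ → X →L[ℝ] X}

/-- Gronwall by a weighted maximum: at the maximum point of `e^(-l(t-τ))‖u - v‖`, the integral
equation gives `D ≤ (CK/l)D` for the maximum `D`, and `l = CK + 1` forces `D = 0`. -/
theorem mild_solution_unique (hL : IsLinearEvolutionProcess L) {f : ℝ → X → X}
    (hf : Continuous fun p : ℝ × X => f p.1 p.2) {K : ℝ} (hK0 : 0 ≤ K)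
    (hK : ∀ t u v, ‖f t u - f t v‖ ≤ K * ‖u - v‖) {τ : ℝ} {x : X} {u v : ℝ → X}
    (hu : ContinuousOn u (Set.Ici τ)) (hv : ContinuousOn v (Set.Ici τ))
    (hu' : ∀ t, τ ≤ t → u t = L t τ x + ∫ s in τ..t, L t s (f s (u s)))
    (hv' : ∀ t, τ ≤ t → v t = L t τ x + ∫ s in τ..t, L t s (f s (v s))) {b : ℝ} (hb : τ ≤ b) :
    u b = v b := by
  obtain ⟨C, hC0, hC⟩ := hL.exists_bound τ b
  set l : ℝ := C * K + 1 with hl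
  have hl0 : 0 < l := by positivity
  have hIcc : ∀ t, Set.Icc τ t ⊆ Set.Ici τ := fun t => Set.Icc_subset_Ici_self
  have hcont : ContinuousOn (fun t => Real.exp (-l * (t - τ)) * ‖u t - v t‖) (Set.Icc τ b) :=
    (by fun_prop : Continuous fun t : ℝ => Real.exp (-l * (t - τ))).continuousOn.mul
      (((hu.mono (hIcc b)).sub (hv.mono (hIcc b))).norm)
  obtain ⟨t₀, ht₀, hmax⟩ := isCompact_Icc.exists_isMaxOn ⟨τ, le_rfl, hb⟩ hcont
  set D : ℝ := Real.exp (-l * (t₀ - τ)) * ‖u t₀ - v t₀‖ with hD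
  have hD0 : 0 ≤ D := by positivity
  have hle : ∀ s ∈ Set.Icc τ b, ‖u s - v s‖ ≤ D * Real.exp (l * (s - τ)) := fun s hs => by
    have h := mul_le_mul_of_nonneg_right (hmax hs) (Real.exp_pos (l * (s - τ))).le
    rwa [mul_right_comm, ← Real.exp_add, show -l * (s - τ) + l * (s - τ) = 0 by ring,
      Real.exp_zero, one_mul] at h
  have hint : ∀ w : ℝ → X, ContinuousOn w (Set.Ici τ) →
      IntervalIntegrable (fun s => L t₀ s (f s (w s))) volume τ t₀ := fun w hw =>
    hL.intervalIntegrable_apply ht₀.1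
      (hf.comp_continuousOn (continuousOn_id.prodMk (hw.mono (hIcc t₀))))
  have h1 : u t₀ - v t₀ = ∫ s in τ..t₀, L t₀ s (f s (u s) - f s (v s)) := by
    rw [hu' t₀ ht₀.1, hv' t₀ ht₀.1, add_sub_add_left_eq_sub,
      ← intervalIntegral.integral_sub (hint u hu) (hint v hv)]
    simp
  -- The integrand is put in the shape of `integral_exp_mul_exp` with rates `0` and `-l`.
  have h2 : ‖u t₀ - v t₀‖ ≤ ∫ s in τ..t₀,
      C * K * D * (Real.exp (-0 * (t₀ - s)) * Real.exp (-(-l) * (s - τ))) := by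
    rw [h1]
    refine intervalIntegral.norm_integral_le_of_norm_le ht₀.1 (ae_of_all _ fun s hs => ?_)
      (Continuous.intervalIntegrable (by fun_prop) _ _)
    have hsI : s ∈ Set.Icc τ b := ⟨hs.1.le, hs.2.trans ht₀.2⟩
    calc ‖L t₀ s (f s (u s) - f s (v s))‖ ≤ C * (K * (D * Real.exp (l * (s - τ)))) := by
          refine ((L t₀ s).le_opNorm _).trans ?_
          gcongr
          · exact hC s t₀ hs.1.le hs.2 ht₀.2
          · exact (hK _ _ _).trans (mul_le_mul_of_nonneg_left (hle s hsI) hK0)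
      _ = _ := by simp; ring
  rw [intervalIntegral.integral_const_mul, integral_exp_mul_exp (by linarith)] at h2
  have h3 : D ≤ C * K * D / l := by
    have h4 := mul_le_mul_of_nonneg_left h2 (Real.exp_pos (-l * (t₀ - τ))).le
    rw [← hD] at h4
    refine h4.trans ?_
    have h5 : Real.exp (-l * (t₀ - τ)) * Real.exp (l * (t₀ - τ)) = 1 := by
      rw [← Real.exp_add]; ring_nf; simp
    have h6 : Real.exp (-l * (t₀ - τ)) * (C * K * D *
        ((Real.exp (-(-l) * (t₀ - τ)) - Real.exp (-0 * (t₀ - τ))) / (0 - -l))) =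
        C * K * D / l * (1 - Real.exp (-l * (t₀ - τ))) := by
      rw [← h5]; simp; ring
    rw [h6]
    refine mul_le_of_le_one_right (by positivity) ?_
    linarith [Real.exp_pos (-l * (t₀ - τ))]
  have h7 : D ≤ 0 := by
    rw [le_div_iff₀ hl0, hl] at h3
    linarith
  have h8 := hle b ⟨hb, le_rfl⟩
  rw [le_antisymm h7 hD0, zero_mul] at h8
  exact sub_eq_zero.1 (norm_le_zero_iff.1 h8)

end MildUniqueness

/-! ### The Lyapunov–Perron formula -/

section LyapunovPerron

variable {X : Type*} [NormedAddCommGroup X] [NormedSpace ℝ X]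
  {L : ℝ → ℝ → X →L[ℝ] X} {Q : ℝ → X →L[ℝ] X} {M γ ρ : ℝ}

/-- The Lyapunov–Perron solution with forcing `F` and stable part `ξ` at time `τ`. -/
noncomputable def lyapunovPerron (hs : HasExponentialSplitting L Q M γ ρ) (τ : ℝ) (ξ : X)
    (F : ℝ → X) (t : ℝ) : X :=
  L t τ (ξ - ∫ s in Set.Ioi τ, hs.backwardCLM τ s (F s)) + ∫ s in τ..t, L t s (F s)

variable [CompleteSpace X] {F G : ℝ → X} {a b σ τ t : ℝ} {ξ : X}

theorem lyapunovPerron_sub (hL : IsLinearEvolutionProcess L)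
    (hs : HasExponentialSplitting L Q M γ ρ) (hF : Continuous F) (hG : Continuous G)
    (hFi : IntegrableOn (fun s => hs.backwardCLM τ s (F s)) (Set.Ioi τ))
    (hGi : IntegrableOn (fun s => hs.backwardCLM τ s (G s)) (Set.Ioi τ)) (ht : τ ≤ t) :
    lyapunovPerron hs τ ξ F t - lyapunovPerron hs τ ξ G t =
      lyapunovPerron hs τ 0 (fun s => F s - G s) t := by
  simp only [lyapunovPerron, map_sub]
  rw [integral_sub hFi hGi, intervalIntegral.integral_sub
    (hL.intervalIntegrable_apply ht hF.continuousOn)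
    (hL.intervalIntegrable_apply ht hG.continuousOn), map_sub, map_zero]
  abel

theorem lyapunovPerron_init_stable (hL : IsLinearEvolutionProcess L)
    (hs : HasExponentialSplitting L Q M γ ρ)
    (hFi : IntegrableOn (fun s => hs.backwardCLM τ s (F s)) (Set.Ioi τ)) (hξ : Q τ ξ = 0) :
    lyapunovPerron hs τ ξ F τ - Q τ (lyapunovPerron hs τ ξ F τ) = ξ := by
  have h2 : Q τ (∫ s in Set.Ioi τ, hs.backwardCLM τ s (F s)) =
      ∫ s in Set.Ioi τ, hs.backwardCLM τ s (F s) := by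
    rw [← ContinuousLinearMap.integral_comp_comm _ hFi]
    exact setIntegral_congr_fun measurableSet_Ioi fun s hts => hs.proj_backwardCLM (le_of_lt hts) _
  simp only [lyapunovPerron, intervalIntegral.integral_same, add_zero, hL.self_apply, map_sub, hξ,
    h2]
  abel

theorem unstableNorm_lyapunovPerron_le (hL : IsLinearEvolutionProcess L)
    (hs : HasExponentialSplitting L Q M γ ρ) (hF : Continuous F) (hρ : ρ < σ)
    (hFa : ∀ s, τ ≤ s → unstableNorm L Q ρ s (Q s (F s)) ≤ a * Real.exp (-σ * (s - τ)))
    (hξ : Q τ ξ = 0) (ht : τ ≤ t) :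
    unstableNorm L Q ρ t (Q t (lyapunovPerron hs τ ξ F t)) ≤
      Real.exp (-σ * (t - τ)) * (a / (σ - ρ)) := by
  rw [← mul_div_assoc]
  refine hs.unstableNorm_le_of_eq_integral hL hF.continuousOn hρ (fun s hts => ?_)
    (hs.proj_mild_eq_neg_integral hL ht hF.continuousOn hρ hFa hξ rfl rfl)
  refine (hFa s (ht.trans hts)).trans_eq ?_
  rw [mul_right_comm, ← Real.exp_add, mul_comm]
  ring_nf

theorem stableNorm_lyapunovPerron_le (hL : IsLinearEvolutionProcess L)
    (hs : HasExponentialSplitting L Q M γ ρ) (hF : Continuous F) (hσ : σ < γ)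
    (hFi : IntegrableOn (fun s => hs.backwardCLM τ s (F s)) (Set.Ioi τ))
    (hFb : ∀ s, τ ≤ s → stableNorm L γ s (F s - Q s (F s)) ≤ b * Real.exp (-σ * (s - τ)))
    (hξ : Q τ ξ = 0) (ht : τ ≤ t) :
    stableNorm L γ t (lyapunovPerron hs τ ξ F t - Q t (lyapunovPerron hs τ ξ F t)) ≤
      Real.exp (-γ * (t - τ)) * stableNorm L γ τ ξ +
        b * ((Real.exp (-σ * (t - τ)) - Real.exp (-γ * (t - τ))) / (γ - σ)) := by
  have h := hs.stableNorm_mild_le_exp hL ht hF.continuousOn (A := 0) hσ hσ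
    (fun s hs' => by simpa using hFb s hs'.1) (lyapunovPerron hs τ ξ F τ)
    (y := lyapunovPerron hs τ ξ F t)
    (by simp [lyapunovPerron, hL.self_apply])
  rwa [lyapunovPerron_init_stable hL hs hFi hξ, zero_mul, add_zero] at h

end LyapunovPerron

/-- A nonlinearity vanishing at zero and Lipschitz with respect to the moving norms. -/
structure IsMovingLipschitz {X : Type*} [NormedAddCommGroup X] [NormedSpace ℝ X]
    (Γ : Seminorm ℝ (ℝ × ℝ)) (L : ℝ → ℝ → X →L[ℝ] X) (Q : ℝ → X →L[ℝ] X) (γ ρ L₁ L₂ : ℝ)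
    (f : ℝ → X → X) : Prop where
  continuous : Continuous fun p : ℝ × X => f p.1 p.2
  map_zero : ∀ t, f t 0 = 0
  pos_left : 0 < L₁
  pos_right : 0 < L₂
  unstable : ∀ (t : ℝ) (u v : X),
    unstableNorm L Q ρ t (Q t (f t u - f t v)) ≤ L₁ * movingNorm Γ L Q γ ρ t (u - v)
  stable : ∀ (t : ℝ) (u v : X),
    stableNorm L γ t ((f t u - f t v) - Q t (f t u - f t v))
      ≤ L₂ * movingNorm Γ L Q γ ρ t (u - v)

/-! ### Existence by a weighted fixed point -/

section Existence

variable {X : Type*} [NormedAddCommGroup X] [NormedSpace ℝ X]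
  {L : ℝ → ℝ → X →L[ℝ] X} {Q : ℝ → X →L[ℝ] X} {M γ ρ L₁ L₂ : ℝ} {Γ : Seminorm ℝ (ℝ × ℝ)}
  {f : ℝ → X → X}

theorem IsMovingLipschitz.exists_lipschitz (hL : IsLinearEvolutionProcess L)
    (hs : HasExponentialSplitting L Q M γ ρ) (hΓ : IsAdmissibleNorm Γ)
    (hf : IsMovingLipschitz Γ L Q γ ρ L₁ L₂ f) :
    ∃ K, 0 ≤ K ∧ ∀ t u v, ‖f t u - f t v‖ ≤ K * ‖u - v‖ := by
  obtain ⟨C, hC0, hC⟩ := exists_movingNorm_le_norm hs hΓ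
  have h1 := hf.pos_left
  have h2 := hf.pos_right
  refine ⟨(L₁ + L₂) * C, by positivity, fun t u v => ?_⟩
  calc ‖f t u - f t v‖ ≤ (L₁ + L₂) * movingNorm Γ L Q γ ρ t (u - v) := by
        rw [add_mul]
        exact (hs.norm_le_add hL t _).trans (add_le_add (hf.unstable t u v) (hf.stable t u v))
    _ ≤ (L₁ + L₂) * C * ‖u - v‖ := by
      rw [mul_assoc]
      exact mul_le_mul_of_nonneg_left (hC t _) (by positivity)

/-- `Set.projIci` freezes the argument of `v` at `τ` for `s < τ`, so that the forcing is continuous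
on all of `ℝ`, as `continuousOn_mild` requires. -/
theorem BoundedContinuousFunction.continuous_exp_smul_projIci (σ : ℝ) {τ : ℝ}
    (v : Set.Ici τ →ᵇ X) :
    Continuous fun s => Real.exp (-σ * (s - τ)) • v (Set.projIci τ s) :=
  Continuous.smul (by fun_prop)
    (v.continuous.comp ((continuous_const.max continuous_id).subtype_mk _))

/-- The forcing term along the exponentially weighted path `v`. -/
noncomputable def weightedForcing (f : ℝ → X → X) (σ τ : ℝ) (v : Set.Ici τ →ᵇ X) (s : ℝ) : X :=
  f s (Real.exp (-σ * (s - τ)) • v (Set.projIci τ s))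

theorem IsMovingLipschitz.continuous_weightedForcing
    (hf : IsMovingLipschitz Γ L Q γ ρ L₁ L₂ f) (σ τ : ℝ) (v : Set.Ici τ →ᵇ X) :
    Continuous (weightedForcing f σ τ v) :=
  hf.continuous.comp (continuous_id.prodMk (v.continuous_exp_smul_projIci σ))

theorem IsMovingLipschitz.exists_weightedForcing_le (hs : HasExponentialSplitting L Q M γ ρ)
    (hΓ : IsAdmissibleNorm Γ) (hf : IsMovingLipschitz Γ L Q γ ρ L₁ L₂ f) (σ τ : ℝ)
    (v : Set.Ici τ →ᵇ X) : ∃ D, 0 ≤ D ∧ ∀ s, τ ≤ s →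
      unstableNorm L Q ρ s (Q s (weightedForcing f σ τ v s)) ≤ D * Real.exp (-σ * (s - τ)) ∧
      stableNorm L γ s (weightedForcing f σ τ v s - Q s (weightedForcing f σ τ v s)) ≤
        D * Real.exp (-σ * (s - τ)) := by
  obtain ⟨C, hC0, hC⟩ := exists_movingNorm_le_norm (L := L) hs hΓ
  have h1 := hf.pos_left
  have h2 := hf.pos_right
  have key : ∀ c, 0 < c → c ≤ L₁ + L₂ → ∀ s, c * movingNorm Γ L Q γ ρ s
      (Real.exp (-σ * (s - τ)) • v (Set.projIci τ s) - 0) ≤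
        (L₁ + L₂) * C * ‖v‖ * Real.exp (-σ * (s - τ)) := fun c hc hc' s => by
    calc _ ≤ (L₁ + L₂) * (C * (Real.exp (-σ * (s - τ)) * ‖v‖)) := by
          refine mul_le_mul hc' ((hC _ _).trans ?_) (apply_nonneg Γ _) (by positivity)
          rw [sub_zero, norm_smul, Real.norm_of_nonneg (Real.exp_pos _).le]
          gcongr
          exact v.norm_coe_le_norm _
      _ = _ := by ring
  refine ⟨(L₁ + L₂) * C * ‖v‖, by positivity, fun s _ => ⟨?_, ?_⟩⟩
  · have := hf.unstable s (Real.exp (-σ * (s - τ)) • v (Set.projIci τ s)) 0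
    rw [hf.map_zero, sub_zero (f s _)] at this
    exact this.trans (key L₁ h1 (by linarith) s)
  · have := hf.stable s (Real.exp (-σ * (s - τ)) • v (Set.projIci τ s)) 0
    rw [hf.map_zero, sub_zero (f s _)] at this
    exact this.trans (key L₂ h2 (by linarith) s)

variable [CompleteSpace X]

theorem IsMovingLipschitz.exists_lyapunovPerron_bounded (hL : IsLinearEvolutionProcess L)
    (hs : HasExponentialSplitting L Q M γ ρ) (hΓ : IsAdmissibleNorm Γ)
    (hf : IsMovingLipschitz Γ L Q γ ρ L₁ L₂ f) {σ : ℝ} (hρ : ρ < σ) (hσ : σ < γ) {τ : ℝ} {ξ : X}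
    (hξ : Q τ ξ = 0) (v : Set.Ici τ →ᵇ X) : ∃ C, ∀ t, τ ≤ t →
      ‖Real.exp (σ * (t - τ)) • lyapunovPerron hs τ ξ (weightedForcing f σ τ v) t‖ ≤ C := by
  obtain ⟨D, hD0, hD⟩ := hf.exists_weightedForcing_le hs hΓ σ τ v
  have hF := hf.continuous_weightedForcing σ τ v
  refine ⟨D / (σ - ρ) + (stableNorm L γ τ ξ + D / (γ - σ)), fun t ht => ?_⟩
  have h1 := unstableNorm_lyapunovPerron_le hL hs hF hρ (fun s h => (hD s h).1) hξ ht
  have h2 := stableNorm_lyapunovPerron_le hL hs hF hσ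
    (hs.integrableOn_backwardCLM hL hF.continuousOn hρ fun s h => (hD s h).1)
    (fun s h => (hD s h).2) hξ ht
  have hS : 0 ≤ stableNorm L γ τ ξ := HasExponentialSplitting.stableNorm_nonneg _ _
  have h3 : Real.exp (-γ * (t - τ)) ≤ Real.exp (-σ * (t - τ)) :=
    Real.exp_le_exp.2 (by nlinarith)
  have h4 : D * ((Real.exp (-σ * (t - τ)) - Real.exp (-γ * (t - τ))) / (γ - σ)) ≤
      Real.exp (-σ * (t - τ)) * (D / (γ - σ)) := by
    rw [← mul_div_assoc, ← mul_div_assoc]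
    refine div_le_div_of_nonneg_right ?_ (sub_pos.2 hσ).le
    rw [mul_comm]
    exact mul_le_mul_of_nonneg_right (by linarith [Real.exp_pos (-γ * (t - τ))]) hD0
  have h5 := hs.norm_le_add hL t (lyapunovPerron hs τ ξ (weightedForcing f σ τ v) t)
  have h6 : Real.exp (σ * (t - τ)) * Real.exp (-σ * (t - τ)) = 1 := by
    rw [← Real.exp_add]; ring_nf; simp
  have h7 : Real.exp (-γ * (t - τ)) * stableNorm L γ τ ξ ≤
      Real.exp (-σ * (t - τ)) * stableNorm L γ τ ξ := mul_le_mul_of_nonneg_right h3 hS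
  rw [norm_smul, Real.norm_of_nonneg (Real.exp_pos _).le]
  calc _ ≤ Real.exp (σ * (t - τ)) * (Real.exp (-σ * (t - τ)) *
        (D / (σ - ρ) + (stableNorm L γ τ ξ + D / (γ - σ)))) := by
        refine mul_le_mul_of_nonneg_left ?_ (Real.exp_pos _).le
        linarith
    _ = _ := by rw [← mul_assoc, h6, one_mul]

/-- The Lyapunov–Perron operator on bounded exponentially weighted paths. -/
noncomputable def lyapunovPerronMap (hL : IsLinearEvolutionProcess L)
    (hs : HasExponentialSplitting L Q M γ ρ) (hΓ : IsAdmissibleNorm Γ)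
    (hf : IsMovingLipschitz Γ L Q γ ρ L₁ L₂ f) {σ : ℝ} (hρ : ρ < σ) (hσ : σ < γ) {τ : ℝ} {ξ : X}
    (hξ : Q τ ξ = 0) (v : Set.Ici τ →ᵇ X) : Set.Ici τ →ᵇ X :=
  BoundedContinuousFunction.ofNormedAddCommGroup
    (fun t => Real.exp (σ * ((t : ℝ) - τ)) • lyapunovPerron hs τ ξ (weightedForcing f σ τ v) t)
    (Continuous.smul (by fun_prop) (continuousOn_iff_continuous_domRestrict.1
      (hL.continuousOn_mild (hf.continuous_weightedForcing σ τ v) τ _)))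
    (hf.exists_lyapunovPerron_bounded hL hs hΓ hρ hσ hξ v).choose
    (fun t => (hf.exists_lyapunovPerron_bounded hL hs hΓ hρ hσ hξ v).choose_spec t t.2)

variable (hL : IsLinearEvolutionProcess L)
    (hs : HasExponentialSplitting L Q M γ ρ) (hΓ : IsAdmissibleNorm Γ)
    (hf : IsMovingLipschitz Γ L Q γ ρ L₁ L₂ f) {σ : ℝ} (hρ : ρ < σ) (hσ : σ < γ) {τ : ℝ} {ξ : X}
    (hξ : Q τ ξ = 0)

theorem exp_neg_smul_lyapunovPerronMap (v : Set.Ici τ →ᵇ X) (t : Set.Ici τ) :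
    Real.exp (-σ * ((t : ℝ) - τ)) • lyapunovPerronMap hL hs hΓ hf hρ hσ hξ v t =
      lyapunovPerron hs τ ξ (weightedForcing f σ τ v) t := by
  change Real.exp (-σ * ((t : ℝ) - τ)) •
    (Real.exp (σ * ((t : ℝ) - τ)) • lyapunovPerron hs τ ξ (weightedForcing f σ τ v) t) = _
  rw [smul_smul, ← Real.exp_add]
  ring_nf
  simp

/-- The difference is a Lyapunov–Perron solution with zero stable datum. Its components carry the
factors `L₁/(σ-ρ)` and `L₂/(γ-σ)`, which monotonicity and homogeneity of `Γ` combine into the gap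
quantity. -/
theorem movingNorm_lyapunovPerronMap_sub_le (v w : Set.Ici τ →ᵇ X) {D : ℝ} (hD : 0 ≤ D)
    (h : ∀ s : Set.Ici τ, movingNorm Γ L Q γ ρ s (Real.exp (-σ * ((s : ℝ) - τ)) • (v s - w s)) ≤
      D * Real.exp (-σ * ((s : ℝ) - τ))) (t : Set.Ici τ) :
    movingNorm Γ L Q γ ρ t (Real.exp (-σ * ((t : ℝ) - τ)) •
      (lyapunovPerronMap hL hs hΓ hf hρ hσ hξ v t - lyapunovPerronMap hL hs hΓ hf hρ hσ hξ w t)) ≤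
      Γ (L₁ / (σ - ρ), L₂ / (γ - σ)) * D * Real.exp (-σ * ((t : ℝ) - τ)) := by
  have hF := hf.continuous_weightedForcing σ τ v
  have hG := hf.continuous_weightedForcing σ τ w
  obtain ⟨D₁, -, hD₁⟩ := hf.exists_weightedForcing_le hs hΓ σ τ v
  obtain ⟨D₂, -, hD₂⟩ := hf.exists_weightedForcing_le hs hΓ σ τ w
  have hFi := hs.integrableOn_backwardCLM hL hF.continuousOn hρ fun s h => (hD₁ s h).1
  have hGi := hs.integrableOn_backwardCLM hL hG.continuousOn hρ fun s h => (hD₂ s h).1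
  have hH : Continuous fun s => weightedForcing f σ τ v s - weightedForcing f σ τ w s := hF.sub hG
  have h' : ∀ s, τ ≤ s → movingNorm Γ L Q γ ρ s
      (Real.exp (-σ * (s - τ)) • v (Set.projIci τ s) -
        Real.exp (-σ * (s - τ)) • w (Set.projIci τ s)) ≤ D * Real.exp (-σ * (s - τ)) :=
    fun s hs' => by
      rw [← smul_sub, Set.projIci_of_mem (a := τ) hs']
      exact h ⟨s, hs'⟩
  have hN : ∀ s, τ ≤ s → unstableNorm L Q ρ s
      (Q s (weightedForcing f σ τ v s - weightedForcing f σ τ w s)) ≤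
        L₁ * D * Real.exp (-σ * (s - τ)) := fun s hs' => by
    rw [mul_assoc]
    exact (hf.unstable s _ _).trans (mul_le_mul_of_nonneg_left (h' s hs') hf.pos_left.le)
  have hS : ∀ s, τ ≤ s → stableNorm L γ s
      ((weightedForcing f σ τ v s - weightedForcing f σ τ w s) -
        Q s (weightedForcing f σ τ v s - weightedForcing f σ τ w s)) ≤
        L₂ * D * Real.exp (-σ * (s - τ)) := fun s hs' => by
    rw [mul_assoc]
    exact (hf.stable s _ _).trans (mul_le_mul_of_nonneg_left (h' s hs') hf.pos_right.le)
  rw [smul_sub, exp_neg_smul_lyapunovPerronMap, exp_neg_smul_lyapunovPerronMap,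
    lyapunovPerron_sub hL hs hF hG hFi hGi t.2]
  have h1 := unstableNorm_lyapunovPerron_le hL hs hH hρ hN (map_zero (Q τ)) t.2
  have h2 := stableNorm_lyapunovPerron_le hL hs hH hσ
    (hs.integrableOn_backwardCLM hL hH.continuousOn hρ hN) hS (map_zero (Q τ)) t.2
  have h0 : stableNorm L γ τ (0 : X) = 0 := by simp [stableNorm]
  rw [h0, mul_zero, zero_add] at h2
  have hγσ := sub_pos.2 hσ
  have hL₂ := hf.pos_right
  set e := Real.exp (-σ * ((t : ℝ) - τ)) with he
  have he0 : 0 < e := Real.exp_pos _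
  have h3 : Γ (D * e * (L₁ / (σ - ρ)), D * e * (L₂ / (γ - σ))) =
      Γ (L₁ / (σ - ρ), L₂ / (γ - σ)) * D * e := by
    rw [IsAdmissibleNorm.map_mul (by positivity)]; ring
  rw [← h3]
  refine hΓ.mono (HasExponentialSplitting.unstableNorm_nonneg _ _)
    (HasExponentialSplitting.stableNorm_nonneg _ _) (h1.trans_eq (by ring)) (h2.trans ?_)
  calc L₂ * D * ((e - Real.exp (-γ * ((t : ℝ) - τ))) / (γ - σ)) ≤ L₂ * D * (e / (γ - σ)) := by
        gcongr
        linarith [Real.exp_pos (-γ * ((t : ℝ) - τ))]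
    _ = _ := by ring

/-- The path space carries the ambient norm, for which the map need not contract. Passing through
the moving norm costs `C₂ * C₁` only once, so the `n`-th iterate has constant `C₂ * C₁ * k ^ n` and
contracts for large `n`. -/
theorem exists_fixedPoint_lyapunovPerronMap (hgap : Γ (L₁ / (σ - ρ), L₂ / (γ - σ)) < 1) :
    ∃ v, lyapunovPerronMap hL hs hΓ hf hρ hσ hξ v = v := by
  set k := Γ (L₁ / (σ - ρ), L₂ / (γ - σ)) with hk
  have hk0 : 0 ≤ k := apply_nonneg Γ _
  set Φ := lyapunovPerronMap hL hs hΓ hf hρ hσ hξ with hΦ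
  obtain ⟨C₁, hC₁0, hC₁⟩ := exists_movingNorm_le_norm (L := L) hs hΓ
  obtain ⟨C₂, hC₂0, hC₂⟩ := exists_norm_le_movingNorm hL hs hΓ
  have iter : ∀ (v w : Set.Ici τ →ᵇ X) (n : ℕ) (t : Set.Ici τ), movingNorm Γ L Q γ ρ t
      (Real.exp (-σ * ((t : ℝ) - τ)) • (Φ^[n] v t - Φ^[n] w t)) ≤
        k ^ n * (C₁ * dist v w) * Real.exp (-σ * ((t : ℝ) - τ)) := fun v w n => by
    induction n with
    | zero =>
      intro t
      refine (hC₁ _ _).trans ?_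
      rw [norm_smul, Real.norm_of_nonneg (Real.exp_pos _).le]
      have := BoundedContinuousFunction.dist_coe_le_dist (f := v) (g := w) t
      rw [dist_eq_norm] at this
      calc _ ≤ C₁ * (Real.exp (-σ * ((t : ℝ) - τ)) * dist v w) := by gcongr; exact this
        _ = _ := by ring
    | succ n ih =>
      intro t
      rw [Function.iterate_succ_apply', Function.iterate_succ_apply', pow_succ', mul_assoc k]
      exact movingNorm_lyapunovPerronMap_sub_le hL hs hΓ hf hρ hσ hξ _ _ (by positivity) ih t
  have hdist : ∀ (n : ℕ) (v w : Set.Ici τ →ᵇ X),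
      dist (Φ^[n] v) (Φ^[n] w) ≤ C₂ * C₁ * k ^ n * dist v w := fun n v w => by
    refine (BoundedContinuousFunction.dist_le (by positivity)).2 fun t => ?_
    rw [dist_eq_norm]
    have h1 := (hC₂ t _).trans (mul_le_mul_of_nonneg_left (iter v w n t) hC₂0.le)
    rw [norm_smul, Real.norm_of_nonneg (Real.exp_pos _).le] at h1
    refine le_of_mul_le_mul_left (h1.trans_eq ?_) (Real.exp_pos (-σ * ((t : ℝ) - τ)))
    ring
  obtain ⟨n, hn⟩ := exists_pow_lt_of_lt_one (inv_pos.2 (mul_pos hC₂0 hC₁0)) hgap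
  have hn1 : C₂ * C₁ * k ^ n < 1 := by
    have := mul_lt_mul_of_pos_left hn (mul_pos hC₂0 hC₁0)
    rwa [mul_inv_cancel₀ (mul_pos hC₂0 hC₁0).ne'] at this
  have hc : ContractingWith (Real.toNNReal (C₂ * C₁ * k ^ n)) Φ^[n] := by
    refine ⟨by rwa [← Real.toNNReal_one, Real.toNNReal_lt_toNNReal_iff one_pos],
      LipschitzWith.of_dist_le_mul fun v w => ?_⟩
    rw [Real.coe_toNNReal _ (by positivity)]
    exact hdist n v w
  exact ⟨_, hc.isFixedPt_fixedPoint_iterate⟩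

theorem exists_mild_solution_of_stable (hL : IsLinearEvolutionProcess L)
    (hs : HasExponentialSplitting L Q M γ ρ) (hΓ : IsAdmissibleNorm Γ)
    (hf : IsMovingLipschitz Γ L Q γ ρ L₁ L₂ f) (hρ : ρ < σ) (hσ : σ < γ) (hξ : Q τ ξ = 0)
    (hgap : Γ (L₁ / (σ - ρ), L₂ / (γ - σ)) < 1) :
    ∃ (x : X) (u : ℝ → X) (C : ℝ), x - Q τ x = ξ ∧ ContinuousOn u (Set.Ici τ) ∧
      (∀ t, τ ≤ t → u t = L t τ x + ∫ s in τ..t, L t s (f s (u s))) ∧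
      ∀ t, τ ≤ t → ‖u t‖ ≤ C * Real.exp (-σ * (t - τ)) := by
  obtain ⟨v, hv⟩ := exists_fixedPoint_lyapunovPerronMap hL hs hΓ hf hρ hσ hξ hgap
  have hF := hf.continuous_weightedForcing σ τ v
  obtain ⟨D, -, hD⟩ := hf.exists_weightedForcing_le hs hΓ σ τ v
  have hFi := hs.integrableOn_backwardCLM hL hF.continuousOn hρ fun s h => (hD s h).1
  set u : ℝ → X := fun t => Real.exp (-σ * (t - τ)) • v (Set.projIci τ t) with hu
  have hu1 : ∀ t, τ ≤ t → u t = lyapunovPerron hs τ ξ (weightedForcing f σ τ v) t :=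
    fun t ht => by
      rw [← exp_neg_smul_lyapunovPerronMap hL hs hΓ hf hρ hσ hξ v ⟨t, ht⟩, hv]
      simp [hu, Set.projIci_of_mem (a := τ) ht]
  refine ⟨lyapunovPerron hs τ ξ (weightedForcing f σ τ v) τ, u, ‖v‖,
    lyapunovPerron_init_stable hL hs hFi hξ, ?_, fun t ht => ?_, fun t _ => ?_⟩
  · exact (v.continuous_exp_smul_projIci σ).continuousOn
  · rw [hu1 t ht]
    simp only [lyapunovPerron, intervalIntegral.integral_same, add_zero, hL.self_apply]
    rfl
  · rw [hu, norm_smul, Real.norm_of_nonneg (Real.exp_pos _).le, mul_comm]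
    gcongr
    exact v.norm_coe_le_norm _

end Existence

/-- The standing assumptions: a nonlinear process given by the variation of constants formula over
a linear process with an exponential splitting, and a rate `σ` satisfying the gap condition. -/
structure IsGapProcess {X : Type*} [NormedAddCommGroup X] [NormedSpace ℝ X]
    (Γ : Seminorm ℝ (ℝ × ℝ)) (L : ℝ → ℝ → X →L[ℝ] X) (Q : ℝ → X →L[ℝ] X) (M γ ρ L₁ L₂ σ : ℝ)
    (f : ℝ → X → X) (T : ℝ → ℝ → X → X) : Prop where
  linear : IsLinearEvolutionProcess L
  splitting : HasExponentialSplitting L Q M γ ρ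
  admissible : IsAdmissibleNorm Γ
  lipschitz : IsMovingLipschitz Γ L Q γ ρ L₁ L₂ f
  process : IsEvolutionProcess T
  mild : ∀ (t τ : ℝ), τ ≤ t → ∀ η : X,
    T t τ η = L t τ η + ∫ s in τ..t, L t s (f s (T s τ η))
  lt_rate : ρ < σ
  rate_lt : σ < γ
  gap : Γ (L₁ / (σ - ρ), L₂ / (γ - σ)) < 1

/-! ### Stable sets and differences of their orbits -/

namespace IsGapProcess

variable {X : Type*} [NormedAddCommGroup X] [NormedSpace ℝ X]
  {Γ : Seminorm ℝ (ℝ × ℝ)} {L : ℝ → ℝ → X →L[ℝ] X} {Q : ℝ → X →L[ℝ] X} {M γ ρ L₁ L₂ σ : ℝ}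
  {f : ℝ → X → X} {T : ℝ → ℝ → X → X}

theorem mapsTo_stableSet (h : IsGapProcess Γ L Q M γ ρ L₁ L₂ σ f T) {t τ : ℝ} (ht : τ ≤ t) :
    Set.MapsTo (T t τ) (stableSet Γ L Q γ ρ σ T τ) (stableSet Γ L Q γ ρ σ T t) := by
  rintro η ⟨C, hC⟩
  refine ⟨C, ?_⟩
  rintro _ ⟨r, hr, rfl⟩
  refine hC ⟨r, ht.trans hr, ?_⟩
  dsimp only
  rw [h.process.comp r t τ ht hr]

theorem mem_stableSet_iff (h : IsGapProcess Γ L Q M γ ρ L₁ L₂ σ f T) {τ : ℝ} {η : X} :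
    η ∈ stableSet Γ L Q γ ρ σ T τ ↔
      ∃ C, ∀ r, τ ≤ r → ‖T r τ η‖ ≤ C * Real.exp (-σ * (r - τ)) := by
  obtain ⟨C₁, hC₁0, hC₁⟩ := exists_movingNorm_le_norm (L := L) h.splitting h.admissible
  obtain ⟨C₂, hC₂0, hC₂⟩ := exists_norm_le_movingNorm h.linear h.splitting h.admissible
  constructor
  · rintro ⟨C, hC⟩
    refine ⟨C₂ * (C * Real.exp (-σ * τ)), fun r hr => (hC₂ r _).trans ?_⟩
    rw [mul_assoc]
    refine mul_le_mul_of_nonneg_left ?_ hC₂0.le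
    have h1 : Real.exp (σ * r) * movingNorm Γ L Q γ ρ r (T r τ η) ≤ C := hC ⟨r, hr, rfl⟩
    have h2 := mul_le_mul_of_nonneg_left h1 (Real.exp_pos (-(σ * r))).le
    rw [← mul_assoc, ← Real.exp_add, neg_add_cancel, Real.exp_zero, one_mul] at h2
    refine h2.trans_eq ?_
    rw [mul_assoc, ← Real.exp_add, mul_comm]
    ring_nf
  · rintro ⟨C, hC⟩
    refine ⟨C₁ * C * Real.exp (σ * τ), ?_⟩
    rintro _ ⟨r, hr, rfl⟩
    have h1 := (hC₁ r _).trans (mul_le_mul_of_nonneg_left (hC r hr) hC₁0.le)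
    refine (mul_le_mul_of_nonneg_left h1 (Real.exp_pos (σ * r)).le).trans_eq ?_
    have : Real.exp (σ * r) * Real.exp (-σ * (r - τ)) = Real.exp (σ * τ) := by
      rw [← Real.exp_add]; ring_nf
    rw [← this]; ring

theorem continuousOn_forcing (h : IsGapProcess Γ L Q M γ ρ L₁ L₂ σ f T) (τ : ℝ) (η : X) :
    ContinuousOn (fun s => f s (T s τ η)) (Set.Ici τ) :=
  h.lipschitz.continuous.comp_continuousOn (continuousOn_id.prodMk (h.process.continuousOn τ η))

variable {τ t μ A D E m : ℝ} {η η' : X}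

/-- The stable sets are Lipschitz graphs over the stable subspaces with constant `m`. -/
def SlopeBound (Γ : Seminorm ℝ (ℝ × ℝ)) (L : ℝ → ℝ → X →L[ℝ] X) (Q : ℝ → X →L[ℝ] X)
    (γ ρ σ : ℝ) (T : ℝ → ℝ → X → X) (m : ℝ) : Prop :=
  ∀ τ, ∀ η ∈ stableSet Γ L Q γ ρ σ T τ, ∀ η' ∈ stableSet Γ L Q γ ρ σ T τ,
    unstableNorm L Q ρ τ (Q τ (η - η')) ≤ m * stableNorm L γ τ ((η - η') - Q τ (η - η'))

theorem movingNorm_sub_le_of_slopeBound (h : IsGapProcess Γ L Q M γ ρ L₁ L₂ σ f T)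
    (hm : SlopeBound Γ L Q γ ρ σ T m) (hη : η ∈ stableSet Γ L Q γ ρ σ T τ)
    (hη' : η' ∈ stableSet Γ L Q γ ρ σ T τ) :
    movingNorm Γ L Q γ ρ τ (η - η') ≤
      Γ (m, 1) * stableNorm L γ τ ((η - η') - Q τ (η - η')) := by
  have hq0 : 0 ≤ stableNorm L γ τ ((η - η') - Q τ (η - η')) :=
    HasExponentialSplitting.stableNorm_nonneg _ _
  rw [mul_comm, ← IsAdmissibleNorm.map_mul hq0, mul_one]
  exact h.admissible.mono (HasExponentialSplitting.unstableNorm_nonneg _ _) hq0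
    ((hm τ η hη η' hη').trans_eq (mul_comm _ _)) le_rfl

theorem exists_movingNorm_sub_le (h : IsGapProcess Γ L Q M γ ρ L₁ L₂ σ f T)
    (hη : η ∈ stableSet Γ L Q γ ρ σ T τ) (hη' : η' ∈ stableSet Γ L Q γ ρ σ T τ) :
    ∃ C, ∀ r, τ ≤ r →
      movingNorm Γ L Q γ ρ r (T r τ η - T r τ η') ≤ C * Real.exp (-σ * (r - τ)) := by
  obtain ⟨C₁, hC₁0, hC₁⟩ := exists_movingNorm_le_norm (L := L) h.splitting h.admissible
  obtain ⟨C, hC⟩ := h.mem_stableSet_iff.1 hη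
  obtain ⟨C', hC'⟩ := h.mem_stableSet_iff.1 hη'
  refine ⟨C₁ * (C + C'), fun r hr => (hC₁ r _).trans ?_⟩
  rw [mul_assoc, add_mul]
  exact mul_le_mul_of_nonneg_left ((norm_sub_le _ _).trans (add_le_add (hC r hr) (hC' r hr)))
    hC₁0.le

variable [CompleteSpace X]

/-- This identifies the abstract fixed point with an actual orbit of `T`. -/
theorem eq_of_mild (h : IsGapProcess Γ L Q M γ ρ L₁ L₂ σ f T) {τ : ℝ} {η : X} {u : ℝ → X}
    (hu : ContinuousOn u (Set.Ici τ))
    (hu' : ∀ t, τ ≤ t → u t = L t τ η + ∫ s in τ..t, L t s (f s (u s))) {t : ℝ} (ht : τ ≤ t) :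
    T t τ η = u t := by
  obtain ⟨K, hK0, hK⟩ := h.lipschitz.exists_lipschitz h.linear h.splitting h.admissible
  exact mild_solution_unique h.linear h.lipschitz.continuous hK0 hK (h.process.continuousOn τ η) hu
    (fun t ht => h.mild t τ ht η) hu' ht

theorem map_zero (h : IsGapProcess Γ L Q M γ ρ L₁ L₂ σ f T) {t τ : ℝ} (ht : τ ≤ t) :
    T t τ 0 = 0 :=
  h.eq_of_mild (u := fun _ => 0) continuousOn_const
    (fun t _ => by simp [h.lipschitz.map_zero]) ht

theorem zero_mem_stableSet (h : IsGapProcess Γ L Q M γ ρ L₁ L₂ σ f T) (τ : ℝ) :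
    (0 : X) ∈ stableSet Γ L Q γ ρ σ T τ :=
  h.mem_stableSet_iff.2 ⟨0, fun r hr => by simp [h.map_zero hr]⟩

theorem exists_mem_stableSet (h : IsGapProcess Γ L Q M γ ρ L₁ L₂ σ f T) {τ : ℝ} {ξ : X}
    (hξ : Q τ ξ = 0) : ∃ η ∈ stableSet Γ L Q γ ρ σ T τ, η - Q τ η = ξ := by
  obtain ⟨x, u, C, hx, hu, hu', hC⟩ := exists_mild_solution_of_stable h.linear h.splitting
    h.admissible h.lipschitz h.lt_rate h.rate_lt hξ h.gap
  refine ⟨x, h.mem_stableSet_iff.2 ⟨C, fun r hr => ?_⟩, hx⟩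
  rw [h.eq_of_mild hu hu' hr]
  exact hC r hr

theorem sub_eq_mild (h : IsGapProcess Γ L Q M γ ρ L₁ L₂ σ f T) (ht : τ ≤ t) :
    T t τ η - T t τ η' = L t τ (η - η') +
      ∫ s in τ..t, L t s (f s (T s τ η) - f s (T s τ η')) := by
  have hi : ∀ η, IntervalIntegrable (fun s => L t s (f s (T s τ η))) volume τ t := fun η =>
    h.linear.intervalIntegrable_apply ht
      ((h.continuousOn_forcing τ η).mono Set.Icc_subset_Ici_self)
  rw [h.mild t τ ht η, h.mild t τ ht η']
  simp only [map_sub]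
  rw [intervalIntegral.integral_sub (hi η) (hi η')]
  abel

theorem unstableNorm_sub_le (h : IsGapProcess Γ L Q M γ ρ L₁ L₂ σ f T) (hμ : ρ < μ)
    (hD : ∀ r, τ ≤ r →
      movingNorm Γ L Q γ ρ r (T r τ η - T r τ η') ≤ D * Real.exp (-μ * (r - τ))) :
    unstableNorm L Q ρ τ (Q τ (η - η')) ≤ L₁ * D / (μ - ρ) := by
  obtain ⟨C, hC0, hC⟩ := exists_norm_le_movingNorm h.linear h.splitting h.admissible
  have hF := (h.continuousOn_forcing τ η).sub (h.continuousOn_forcing τ η')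
  have hFA : ∀ s, τ ≤ s → unstableNorm L Q ρ s (Q s (f s (T s τ η) - f s (T s τ η'))) ≤
      L₁ * D * Real.exp (-μ * (s - τ)) := fun s hs => by
    rw [mul_assoc]
    exact (h.lipschitz.unstable s _ _).trans
      (mul_le_mul_of_nonneg_left (hD s hs) h.lipschitz.pos_left.le)
  refine h.splitting.unstableNorm_le_of_eq_integral h.linear hF hμ hFA
    (h.splitting.proj_eq_neg_integral h.linear hF hμ hFA (fun r hr => h.sub_eq_mild hr)
      (C := C * D * Real.exp (μ * τ)) fun r hr => ?_)
  refine (hC r _).trans ((mul_le_mul_of_nonneg_left (hD r hr) hC0.le).trans_eq ?_)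
  rw [mul_assoc _ (Real.exp _) (Real.exp _), ← Real.exp_add, ← mul_assoc]
  ring_nf

/-- The estimate at the initial time is restarted at `t` by the process property. -/
theorem unstableNorm_sub_le_exp (h : IsGapProcess Γ L Q M γ ρ L₁ L₂ σ f T) (hμ : ρ < μ)
    (hD : ∀ r, τ ≤ r →
      movingNorm Γ L Q γ ρ r (T r τ η - T r τ η') ≤ D * Real.exp (-μ * (r - τ))) (ht : τ ≤ t) :
    unstableNorm L Q ρ t (Q t (T t τ η - T t τ η')) ≤
      L₁ / (μ - ρ) * (D * Real.exp (-μ * (t - τ))) := by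
  refine (h.unstableNorm_sub_le (D := D * Real.exp (-μ * (t - τ))) hμ fun r hr => ?_).trans_eq
    (by ring)
  rw [← h.process.comp r t τ ht hr, ← h.process.comp r t τ ht hr, mul_assoc, ← Real.exp_add]
  refine (hD r (ht.trans hr)).trans_eq ?_
  ring_nf

theorem stableNorm_sub_le (h : IsGapProcess Γ L Q M γ ρ L₁ L₂ σ f T) (hμ : μ < γ)
    (hD : ∀ r, τ ≤ r → movingNorm Γ L Q γ ρ r (T r τ η - T r τ η') ≤
      A * Real.exp (-μ * (r - τ)) + E * Real.exp (-σ * (r - τ))) (ht : τ ≤ t) :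
    stableNorm L γ t ((T t τ η - T t τ η') - Q t (T t τ η - T t τ η')) ≤
      Real.exp (-γ * (t - τ)) * stableNorm L γ τ ((η - η') - Q τ (η - η')) +
      L₂ * A * ((Real.exp (-μ * (t - τ)) - Real.exp (-γ * (t - τ))) / (γ - μ)) +
      L₂ * E * ((Real.exp (-σ * (t - τ)) - Real.exp (-γ * (t - τ))) / (γ - σ)) := by
  have hF := (h.continuousOn_forcing τ η).sub (h.continuousOn_forcing τ η')
  refine h.splitting.stableNorm_mild_le_exp h.linear ht (hF.mono Set.Icc_subset_Ici_self) hμ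
    h.rate_lt (fun s hs => ?_) _ (h.sub_eq_mild ht)
  rw [mul_assoc, mul_assoc, ← mul_add]
  exact (h.lipschitz.stable s _ _).trans
    (mul_le_mul_of_nonneg_left (hD s hs.1) h.lipschitz.pos_right.le)

/-- Let `D` be the weighted supremum of the difference of two orbits and `q` its initial stable
norm. The unstable norm is at most `L₁D/(σ-ρ)`, so it suffices to bound `D` by `(γ-σ)q/L₂`, unless
`D = 0`. -/
theorem slopeBound_initial (h : IsGapProcess Γ L Q M γ ρ L₁ L₂ σ f T) :
    SlopeBound Γ L Q γ ρ σ T (L₁ / L₂ * ((γ - σ) / (σ - ρ))) := by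
  intro τ η hη η' hη'
  obtain ⟨C, hC⟩ := h.exists_movingNorm_sub_le hη hη'
  have hσρ := sub_pos.2 h.lt_rate
  have hγσ := sub_pos.2 h.rate_lt
  have hL₁ := h.lipschitz.pos_left
  have hL₂ := h.lipschitz.pos_right
  set g : Set.Ici τ → ℝ := fun r =>
    Real.exp (σ * ((r : ℝ) - τ)) * movingNorm Γ L Q γ ρ r (T r τ η - T r τ η') with hg
  have hexp : ∀ r : ℝ, Real.exp (σ * (r - τ)) * Real.exp (-σ * (r - τ)) = 1 := fun r => by
    rw [← Real.exp_add]; ring_nf; simp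
  have hgle : ∀ (r : Set.Ici τ) (D : ℝ), g r ≤ D ↔
      movingNorm Γ L Q γ ρ r (T r τ η - T r τ η') ≤ D * Real.exp (-σ * ((r : ℝ) - τ)) :=
    fun r D => by
      rw [← mul_le_mul_iff_of_pos_left (Real.exp_pos (σ * ((r : ℝ) - τ))) 
        (b := movingNorm _ _ _ _ _ _ _), mul_left_comm, hexp, mul_one]
  have hbdd : BddAbove (Set.range g) := ⟨C, by
    rintro _ ⟨r, rfl⟩
    exact (hgle r C).2 (hC r r.2)⟩
  have hne : Nonempty (Set.Ici τ) := ⟨⟨τ, Set.self_mem_Ici⟩⟩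
  set D := ⨆ r, g r with hDdef
  have hD0 : 0 ≤ D := Real.iSup_nonneg fun r => mul_nonneg (Real.exp_pos _).le (apply_nonneg Γ _)
  have hD : ∀ r, τ ≤ r → movingNorm Γ L Q γ ρ r (T r τ η - T r τ η') ≤
      D * Real.exp (-σ * (r - τ)) := fun r hr => (hgle ⟨r, hr⟩ D).1 (le_ciSup hbdd _)
  have hp := h.unstableNorm_sub_le h.lt_rate hD
  set q := stableNorm L γ τ ((η - η') - Q τ (η - η')) with hq
  have hq0 : 0 ≤ q := HasExponentialSplitting.stableNorm_nonneg _ _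
  -- In the first case the stable bound `e'q + (e - e')L₂D/(γ-σ)` is at most `eL₂D/(γ-σ)`, so the
  -- gap condition forces `D = 0`. The second case is the wanted bound on `D`.
  rcases le_or_gt q (L₂ / (γ - σ) * D) with hle | hlt
  · have hD1 : D ≤ Γ (L₁ / (σ - ρ), L₂ / (γ - σ)) * D := by
      refine ciSup_le fun r => (hgle r _).2 ?_
      have h1 := h.unstableNorm_sub_le_exp h.lt_rate hD r.2
      have h2 := h.stableNorm_sub_le (A := 0) h.rate_lt
        (fun r hr => by simpa using hD r hr) r.2
      rw [← hq] at h2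
      set e := Real.exp (-σ * ((r : ℝ) - τ))
      set e' := Real.exp (-γ * ((r : ℝ) - τ))
      have he : 0 < e := Real.exp_pos _
      have he' : 0 < e' := Real.exp_pos _
      have h3 : e' * q ≤ e' * (L₂ / (γ - σ) * D) := mul_le_mul_of_nonneg_left hle he'.le
      have h4 : L₂ * D * ((e - e') / (γ - σ)) = (e - e') * (L₂ / (γ - σ) * D) := by ring
      have h5 : Γ (D * e * (L₁ / (σ - ρ)), D * e * (L₂ / (γ - σ))) =
          Γ (L₁ / (σ - ρ), L₂ / (γ - σ)) * D * e := by
        rw [IsAdmissibleNorm.map_mul (by positivity)]; ring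
      rw [← h5]
      exact h.admissible.mono (HasExponentialSplitting.unstableNorm_nonneg _ _)
        (HasExponentialSplitting.stableNorm_nonneg _ _) (by linarith) (by linarith)
    have hD2 : D = 0 := by
      have := h.gap
      nlinarith
    rw [hD2, mul_zero, zero_div] at hp
    exact hp.trans (by positivity)
  · refine hp.trans ?_
    calc L₁ * D / (σ - ρ) = L₁ / L₂ * ((γ - σ) / (σ - ρ)) * (L₂ / (γ - σ) * D) := by
          field_simp
      _ ≤ _ := by gcongr

/-- On the graph the moving norm is at most `Γ(m,1)` times the stable norm, which closes the stable
integral inequality. It is solved by iteration from the crude rate `σ`. -/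
theorem stableNorm_sub_le_of_slopeBound (h : IsGapProcess Γ L Q M γ ρ L₁ L₂ σ f T)
    (hm : SlopeBound Γ L Q γ ρ σ T m) (hmσ : L₂ * Γ (m, 1) < γ - σ)
    (hη : η ∈ stableSet Γ L Q γ ρ σ T τ) (hη' : η' ∈ stableSet Γ L Q γ ρ σ T τ) (ht : τ ≤ t) :
    stableNorm L γ t ((T t τ η - T t τ η') - Q t (T t τ η - T t τ η')) ≤
      stableNorm L γ τ ((η - η') - Q τ (η - η')) *
        Real.exp (-(γ - L₂ * Γ (m, 1)) * (t - τ)) := by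
  have hγσ := sub_pos.2 h.rate_lt
  have hL₂ := h.lipschitz.pos_right
  have hΓm : 0 < Γ (m, 1) := h.admissible.pos (by simp)
  set c := L₂ * Γ (m, 1) with hc
  have hc0 : 0 < c := by positivity
  set q := stableNorm L γ τ ((η - η') - Q τ (η - η')) with hq
  have hq0 : 0 ≤ q := HasExponentialSplitting.stableNorm_nonneg _ _
  obtain ⟨C, hC⟩ := h.exists_movingNorm_sub_le hη hη'
  have hC0 : 0 ≤ C := by
    have := (apply_nonneg Γ _).trans (hC τ le_rfl)
    simpa using this
  have hmn : ∀ r, τ ≤ r → movingNorm Γ L Q γ ρ r (T r τ η - T r τ η') ≤ Γ (m, 1) *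
      stableNorm L γ r ((T r τ η - T r τ η') - Q r (T r τ η - T r τ η')) := fun r hr =>
    h.movingNorm_sub_le_of_slopeBound hm (h.mapsTo_stableSet hr hη) (h.mapsTo_stableSet hr hη')
  have key : ∀ n : ℕ, ∀ r, τ ≤ r → movingNorm Γ L Q γ ρ r (T r τ η - T r τ η') ≤
      Γ (m, 1) * q * Real.exp (-(γ - c) * (r - τ)) +
        (c / (γ - σ)) ^ n * C * Real.exp (-σ * (r - τ)) := fun n => by
    induction n with
    | zero =>
      intro r hr
      have : 0 ≤ Γ (m, 1) * q * Real.exp (-(γ - c) * (r - τ)) := by positivity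
      have := hC r hr
      rw [pow_zero, one_mul]
      linarith
    | succ n ih =>
      intro r hr
      refine (hmn r hr).trans ?_
      -- With `μ = γ - c` the leading term reproduces itself, as `e₁q + q(e₂ - e₁) = qe₂`, while the
      -- error gains a factor `c/(γ-σ) < 1`.
      have h1 := h.stableNorm_sub_le (by linarith) ih hr
      rw [← hq, sub_sub_cancel] at h1
      set e := Real.exp (-σ * (r - τ))
      set e₁ := Real.exp (-γ * (r - τ))
      set e₂ := Real.exp (-(γ - c) * (r - τ))
      have he₁ : 0 < e₁ := Real.exp_pos _
      have h2 : L₂ * (Γ (m, 1) * q) * ((e₂ - e₁) / c) = q * (e₂ - e₁) := by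
        rw [← mul_assoc, ← hc]; field_simp
      have h3 : Γ (m, 1) * (L₂ * ((c / (γ - σ)) ^ n * C) * ((e - e₁) / (γ - σ))) =
          (c / (γ - σ)) ^ (n + 1) * C * (e - e₁) := by
        rw [pow_succ]
        nth_rw 3 [hc]
        ring
      have h4 : (c / (γ - σ)) ^ (n + 1) * C * (e - e₁) ≤ (c / (γ - σ)) ^ (n + 1) * C * e := by
        gcongr
        linarith
      calc _ ≤ _ := mul_le_mul_of_nonneg_left h1 hΓm.le
        _ = Γ (m, 1) * q * e₂ + Γ (m, 1) *
            (L₂ * ((c / (γ - σ)) ^ n * C) * ((e - e₁) / (γ - σ))) := by rw [h2]; ring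
        _ ≤ _ := by rw [h3]; linarith
  have hlim : ∀ r, τ ≤ r → movingNorm Γ L Q γ ρ r (T r τ η - T r τ η') ≤
      Γ (m, 1) * q * Real.exp (-(γ - c) * (r - τ)) + 0 * Real.exp (-σ * (r - τ)) :=
    fun r hr => by
      have hpow : Tendsto (fun n : ℕ => (c / (γ - σ)) ^ n * C) atTop (𝓝 0) := by
        rw [← zero_mul C]
        refine (tendsto_pow_atTop_nhds_zero_of_lt_one (by positivity) ?_).mul_const C
        rwa [div_lt_one hγσ]
      exact ge_of_tendsto' ((hpow.mul_const _).const_add _) fun n => key n r hr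
  have h1 := h.stableNorm_sub_le (by linarith) hlim ht
  rw [← hq, sub_sub_cancel, mul_zero, zero_mul, add_zero, ← mul_assoc, ← hc] at h1
  refine h1.trans_eq ?_
  field_simp
  ring

theorem slopeBound_step (h : IsGapProcess Γ L Q M γ ρ L₁ L₂ σ f T)
    (hm : SlopeBound Γ L Q γ ρ σ T m) (hmσ : L₂ * Γ (m, 1) < γ - σ) :
    SlopeBound Γ L Q γ ρ σ T (L₁ * Γ (m, 1) / (γ - ρ - L₂ * Γ (m, 1))) := by
  intro τ η hη η' hη'
  have hρσ := h.lt_rate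
  have hΓm : 0 ≤ Γ (m, 1) := apply_nonneg Γ _
  refine (h.unstableNorm_sub_le (μ := γ - L₂ * Γ (m, 1))
    (D := Γ (m, 1) * stableNorm L γ τ ((η - η') - Q τ (η - η'))) (by linarith)
    fun r hr => ?_).trans_eq ?_
  · rw [mul_assoc]
    exact (h.movingNorm_sub_le_of_slopeBound hm (h.mapsTo_stableSet hr hη)
      (h.mapsTo_stableSet hr hη')).trans (mul_le_mul_of_nonneg_left
        (h.stableNorm_sub_le_of_slopeBound hm hmσ hη hη' hr) hΓm)
  · rw [sub_right_comm]; ring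

/-- If the infimum of the admissible slopes above `κ` exceeded `κ`, `slopeBound_step` would produce
a strictly smaller one. -/
theorem slopeBound_of_root (h : IsGapProcess Γ L Q M γ ρ L₁ L₂ σ f T) {κ κ₀ : ℝ} (hκ : 0 < κ)
    (hκκ₀ : κ ≤ κ₀) (h₀ : SlopeBound Γ L Q γ ρ σ T κ₀) (hκ₀ : L₂ * Γ (κ₀, 1) < γ - σ)
    (hlt : ∀ m, κ < m → m ≤ κ₀ → (L₁ / m + L₂) * Γ (m, 1) < γ - ρ) :
    SlopeBound Γ L Q γ ρ σ T κ := by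
  have hρσ := h.lt_rate
  have hL₁ := h.lipschitz.pos_left
  have hL₂ := h.lipschitz.pos_right
  set S : Set ℝ := {m | κ ≤ m ∧ SlopeBound Γ L Q γ ρ σ T m} with hS
  have hSne : κ₀ ∈ S := ⟨hκκ₀, h₀⟩
  have hSb : BddBelow S := ⟨κ, fun m hm => hm.1⟩
  set m := sInf S with hm
  have hκm : κ ≤ m := le_csInf ⟨_, hSne⟩ fun m hm => hm.1
  have hmκ₀ : m ≤ κ₀ := csInf_le hSb hSne
  -- The slope inequalities are closed in `m`, so the infimum is attained; the `+ 1` in the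
  -- denominator allows a vanishing stable norm.
  have hmS : SlopeBound Γ L Q γ ρ σ T m := fun τ η hη η' hη' => by
    have hq0 : 0 ≤ stableNorm L γ τ ((η - η') - Q τ (η - η')) :=
      HasExponentialSplitting.stableNorm_nonneg _ _
    refine le_of_forall_pos_le_add fun ε hε => ?_
    obtain ⟨m', hm', hlt'⟩ := exists_lt_of_csInf_lt (⟨_, hSne⟩ : S.Nonempty)
      (show sInf S < m + ε / (stableNorm L γ τ ((η - η') - Q τ (η - η')) + 1) from
        lt_add_of_pos_right _ (by positivity))
    refine (hm'.2 τ η hη η' hη').trans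
      ((mul_le_mul_of_nonneg_right hlt'.le hq0).trans ?_)
    rw [add_mul]
    gcongr
    rw [div_mul_eq_mul_div, div_le_iff₀ (by positivity)]
    nlinarith
  rcases hκm.eq_or_lt with heq | hlt'
  · rwa [heq]
  · exfalso
    have hm0 : 0 < m := hκ.trans hlt'
    have hmσ : L₂ * Γ (m, 1) < γ - σ := lt_of_le_of_lt
      (mul_le_mul_of_nonneg_left (h.admissible.mono hm0.le zero_le_one hmκ₀ le_rfl) hL₂.le) hκ₀
    have h1 := h.slopeBound_step hmS hmσ
    have h2 := hlt m hlt' hmκ₀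
    have h3 : L₁ * Γ (m, 1) / (γ - ρ - L₂ * Γ (m, 1)) < m := by
      rw [div_lt_iff₀ (by linarith)]
      have := mul_lt_mul_of_pos_left h2 hm0
      rw [← mul_assoc, mul_add, mul_div_cancel₀ _ hm0.ne'] at this
      linarith
    -- The improved slope may fall below `κ`; the maximum keeps it in `S`.
    have h4 : max κ (L₁ * Γ (m, 1) / (γ - ρ - L₂ * Γ (m, 1))) ∈ S := by
      refine ⟨le_max_left _ _, fun τ η hη η' hη' => (h1 τ η hη η' hη').trans ?_⟩
      exact mul_le_mul_of_nonneg_right (le_max_right _ _)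
        (HasExponentialSplitting.stableNorm_nonneg _ _)
    exact absurd (csInf_le hSb h4) (not_le.2 (max_lt hlt' h3))

end IsGapProcess

/-- The largest root below `κ₀` of the equation for the optimal slope. -/
theorem exists_slope_root {Γ : Seminorm ℝ (ℝ × ℝ)} (hΓ : IsAdmissibleNorm Γ) {L₁ L₂ κ₀ d : ℝ}
    (hL₁ : 0 < L₁) (hL₂ : 0 < L₂) (hκ₀ : 0 < κ₀) (hd : (L₁ / κ₀ + L₂) * Γ (κ₀, 1) < d) :
    ∃ κ, 0 < κ ∧ κ < κ₀ ∧ (L₁ / κ + L₂) * Γ (κ, 1) = d ∧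
      ∀ m, κ < m → m ≤ κ₀ → (L₁ / m + L₂) * Γ (m, 1) < d := by
  have hcont : Continuous fun m : ℝ => Γ (m, 1) := by
    refine (LipschitzWith.of_dist_le_mul (K := (Γ (1, 0)).toNNReal) fun m m' => ?_).continuous
    rw [Real.coe_toNNReal _ (apply_nonneg Γ _), Real.dist_eq, Real.dist_eq]
    have h1 := abs_sub_map_le_sub Γ (m, 1) (m', 1)
    have h2 := map_smul_eq_mul Γ (m - m') (1, 0)
    simp only [Prod.mk_sub_mk, sub_self, Prod.smul_mk, smul_eq_mul, mul_one, mul_zero,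
      Real.norm_eq_abs] at h1 h2
    rw [h2] at h1
    linarith
  set φ : ℝ → ℝ := fun m => (L₁ / m + L₂) * Γ (m, 1) with hφ
  have hG : 0 < Γ (0, 1) := hΓ.pos (by simp)
  have hd0 : 0 < d := lt_of_le_of_lt (by positivity) hd
  have hφc : ContinuousOn φ (Set.Ioi 0) := by
    refine ContinuousOn.mul (ContinuousOn.add ?_ continuousOn_const) hcont.continuousOn
    exact continuousOn_const.div continuousOn_id fun m hm => (ne_of_gt hm)
  -- Small enough that `L₁Γ(0,1)/ε ≥ d`, which already forces `φ ε ≥ d`.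
  set ε := min κ₀ (L₁ * Γ (0, 1) / d) with hε
  have hε0 : 0 < ε := lt_min hκ₀ (by positivity)
  have hφε : d ≤ φ ε := by
    have h1 : Γ (0, 1) ≤ Γ (ε, 1) := hΓ.mono le_rfl zero_le_one hε0.le le_rfl
    have h2 : d ≤ L₁ / ε * Γ (0, 1) := by
      rw [div_mul_eq_mul_div, le_div_iff₀ hε0, mul_comm, ← le_div_iff₀ hd0]
      exact min_le_right _ _
    calc d ≤ L₁ / ε * Γ (0, 1) := h2
      _ ≤ (L₁ / ε + L₂) * Γ (ε, 1) := by gcongr; linarith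
  have hcpt : IsCompact (Set.Icc ε κ₀ ∩ φ ⁻¹' Set.Ici d) :=
    isCompact_Icc.of_isClosed_subset
      ((hφc.mono fun m hm => hε0.trans_le hm.1).preimage_isClosed_of_isClosed
        isClosed_Icc isClosed_Ici) Set.inter_subset_left
  obtain ⟨κ, hκ, hmax⟩ := hcpt.exists_isGreatest ⟨ε, ⟨le_rfl, min_le_left _ _⟩, hφε⟩
  have hκ0 : 0 < κ := hε0.trans_le hκ.1.1
  have hlt : ∀ m, κ < m → m ≤ κ₀ → φ m < d := fun m h1 h2 => by
    by_contra! h3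
    exact absurd (hmax ⟨⟨hκ.1.1.trans h1.le, h2⟩, h3⟩) (not_le.2 h1)
  have hκκ₀ : κ < κ₀ := lt_of_le_of_ne hκ.1.2 fun h => by
    have : d ≤ φ κ := hκ.2
    rw [h] at this
    exact absurd this (not_le.2 hd)
  refine ⟨κ, hκ0, hκκ₀, ?_, hlt⟩
  -- So far only `φ κ ≥ d`. A point of `[κ, κ₀]` where `φ = d` cannot lie beyond `κ`, hence is `κ`.
  obtain ⟨m, hm, hφm⟩ := intermediate_value_Icc' hκκ₀.le
    (hφc.mono fun m hm => hκ0.trans_le hm.1) ⟨hd.le, hκ.2⟩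
  rcases hm.1.eq_or_lt with heq | h1
  · rw [heq]; exact hφm
  · exact absurd hφm (hlt m h1 hm.2).ne

/-! ### The invariant graph -/

theorem theorem4p1 {X : Type*} [NormedAddCommGroup X] [NormedSpace ℝ X] [CompleteSpace X]
    (L : ℝ → ℝ → X →L[ℝ] X) (hL : IsLinearEvolutionProcess L)
    (Q : ℝ → X →L[ℝ] X) (M γ ρ : ℝ) (hsplit : HasExponentialSplitting L Q M γ ρ)
    (Γ : Seminorm ℝ (ℝ × ℝ)) (hΓ : IsAdmissibleNorm Γ)
    (f : ℝ → X → X) (hf : Continuous (fun p : ℝ × X => f p.1 p.2)) (hf0 : ∀ t : ℝ, f t 0 = 0)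
    (L₁ L₂ : ℝ) (hL₁ : 0 < L₁) (hL₂ : 0 < L₂)
    (hfN : ∀ (t : ℝ) (u v : X),
      unstableNorm L Q ρ t (Q t (f t u - f t v)) ≤ L₁ * movingNorm Γ L Q γ ρ t (u - v))
    (hfS : ∀ (t : ℝ) (u v : X),
      stableNorm L γ t ((f t u - f t v) - Q t (f t u - f t v))
        ≤ L₂ * movingNorm Γ L Q γ ρ t (u - v))
    (T : ℝ → ℝ → X → X) (hT : IsEvolutionProcess T)
    (hvcf : ∀ (t τ : ℝ), τ ≤ t → ∀ η : X,
      T t τ η = L t τ η + ∫ s in τ..t, L t s (f s (T s τ η)))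
    (σ : ℝ) (hρσ : ρ < σ) (hσγ : σ < γ) (hgap : Γ (L₁ / (σ - ρ), L₂ / (γ - σ)) < 1) :
    (∀ t τ : ℝ, τ ≤ t →
      Set.MapsTo (T t τ) (stableSet Γ L Q γ ρ σ T τ) (stableSet Γ L Q γ ρ σ T t)) ∧
    ∃ κ : ℝ, 0 < κ ∧ κ < L₁ / L₂ * ((γ - σ) / (σ - ρ)) ∧
      γ - ρ = L₁ * Γ (1, 1 / κ) + L₂ * Γ (κ, 1) ∧
      ∃ Θ : ℝ → X → X,
        (∀ t : ℝ, stableSet Γ L Q γ ρ σ T t = Set.range (fun u => Θ t u + (u - Q t u))) ∧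
        (∀ (t : ℝ) (u : X), Θ t u = Θ t (u - Q t u)) ∧
        (∀ (t : ℝ) (u : X), Θ t u = Q t (Θ t u)) ∧
        (∀ t : ℝ, Θ t 0 = 0) ∧
        (∀ (t : ℝ) (η η' : X),
          unstableNorm L Q ρ t (Θ t η - Θ t η')
            ≤ κ * stableNorm L γ t ((η - η') - Q t (η - η'))) ∧
        (∀ (t τ : ℝ), τ ≤ t → ∀ u : X,
          movingNorm Γ L Q γ ρ t (T t τ (Θ τ u + (u - Q τ u)))
            ≤ Γ (κ, 1) / Γ (0, 1) * Real.exp (-(γ - L₂ * Γ (κ, 1)) * (t - τ))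
              * movingNorm Γ L Q γ ρ τ (Θ τ u + (u - Q τ u))) := by
  have h : IsGapProcess Γ L Q M γ ρ L₁ L₂ σ f T :=
    ⟨hL, hsplit, hΓ, ⟨hf, hf0, hL₁, hL₂, hfN, hfS⟩, hT, hvcf, hρσ, hσγ, hgap⟩
  have hσρ := sub_pos.2 hρσ
  have hγσ := sub_pos.2 hσγ
  refine ⟨fun t τ ht => h.mapsTo_stableSet ht, ?_⟩
  set κ₀ : ℝ := L₁ / L₂ * ((γ - σ) / (σ - ρ)) with hκ₀def
  have hκ₀ : 0 < κ₀ := by positivity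
  -- `(κ₀, 1)` is the vector of the gap condition rescaled by `(γ-σ)/L₂`, so that condition yields
  -- both strict inequalities at `κ₀`.
  have hΓκ₀ : Γ (κ₀, 1) = (γ - σ) / L₂ * Γ (L₁ / (σ - ρ), L₂ / (γ - σ)) := by
    rw [← IsAdmissibleNorm.map_mul (by positivity)]
    congr 2
    · rw [hκ₀def]; field_simp
    · field_simp
  have hκ₀lt : L₂ * Γ (κ₀, 1) < γ - σ := by
    rw [hΓκ₀, ← mul_assoc, mul_div_cancel₀ _ hL₂.ne']
    exact mul_lt_of_lt_one_right hγσ hgap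
  have hd : (L₁ / κ₀ + L₂) * Γ (κ₀, 1) < γ - ρ := by
    have h1 : L₁ / κ₀ + L₂ = L₂ / (γ - σ) * (γ - ρ) := by
      rw [hκ₀def]; field_simp; ring
    have h2 : L₂ / (γ - σ) * (γ - ρ) * ((γ - σ) / L₂ * Γ (L₁ / (σ - ρ), L₂ / (γ - σ))) =
        (γ - ρ) * Γ (L₁ / (σ - ρ), L₂ / (γ - σ)) := by field_simp
    rw [h1, hΓκ₀, h2]
    exact mul_lt_of_lt_one_right (by linarith) hgap
  obtain ⟨κ, hκ, hκκ₀, hroot, hlt⟩ := exists_slope_root hΓ hL₁ hL₂ hκ₀ hd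
  have hslope := h.slopeBound_of_root hκ hκκ₀.le h.slopeBound_initial hκ₀lt hlt
  have hκσ : L₂ * Γ (κ, 1) < γ - σ := lt_of_le_of_lt
    (mul_le_mul_of_nonneg_left (hΓ.mono hκ.le zero_le_one hκκ₀.le le_rfl) hL₂.le) hκ₀lt
  have hker : ∀ t u, Q t (u - Q t u) = 0 := fun t u => by
    rw [map_sub, hsplit.proj_apply, sub_self]
  -- `G t ξ` is the point of the stable set above `ξ`; `Θ` will be its unstable part.
  choose! G hGmem hGeq using fun (t : ℝ) (ξ : X) (hξ : Q t ξ = 0) => h.exists_mem_stableSet hξ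
  have huniq : ∀ t, ∀ η ∈ stableSet Γ L Q γ ρ σ T t, ∀ η' ∈ stableSet Γ L Q γ ρ σ T t,
      η - Q t η = η' - Q t η' → η = η' := fun t η hη η' hη' heq => by
    have h0 : (η - η') - Q t (η - η') = 0 := by
      rw [map_sub, sub_sub_sub_comm, heq, sub_self]
    have h1 := hslope t η hη η' hη'
    have h2 := hsplit.norm_le_add hL t (η - η')
    have h3 : stableNorm L γ t (0 : X) = 0 := by simp [stableNorm]
    rw [h0, h3] at h1 h2
    exact sub_eq_zero.1 (norm_le_zero_iff.1 (by linarith))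
  have hgraph : ∀ t u, Q t (G t (u - Q t u)) + (u - Q t u) = G t (u - Q t u) := fun t u => by
    nth_rw 2 [← hGeq t _ (hker t u)]
    abel
  have hmem : ∀ t u, G t (u - Q t u) ∈ stableSet Γ L Q γ ρ σ T t := fun t u =>
    hGmem t _ (hker t u)
  have hidem : ∀ t u, (u - Q t u) - Q t (u - Q t u) = u - Q t u := fun t u => by
    rw [hker, sub_zero]
  refine ⟨κ, hκ, hκκ₀, ?_, fun t u => Q t (G t (u - Q t u)), fun t => ?_, fun t u => ?_,
    fun t u => ?_, fun t => ?_, fun t η η' => ?_, fun t τ ht u => ?_⟩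
  · rw [← hroot, add_mul]
    congr 1
    have h1 : Γ (1, 1 / κ) = κ⁻¹ * Γ (κ, 1) := by
      rw [← IsAdmissibleNorm.map_mul (by positivity), inv_mul_cancel₀ hκ.ne', mul_one, one_div]
    rw [h1]; ring
  · simp only [hgraph]
    refine Set.Subset.antisymm (fun η hη => ⟨η, ?_⟩) ?_
    · exact huniq t _ (hmem t η) η hη (hGeq t _ (hker t η))
    · rintro _ ⟨u, rfl⟩
      exact hmem t u
  · simp only [hidem]
  · exact (hsplit.proj_apply t _).symm
  · have h0 : G t 0 = 0 := huniq t _ (hGmem t 0 (map_zero _)) 0 (h.zero_mem_stableSet t)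
      (by rw [hGeq t 0 (map_zero _)]; simp)
    simp [h0]
  · have h1 := hslope t _ (hmem t η) _ (hmem t η')
    have h2 : (G t (η - Q t η) - G t (η' - Q t η')) -
        Q t (G t (η - Q t η) - G t (η' - Q t η')) = (η - η') - Q t (η - η') := by
      rw [map_sub, sub_sub_sub_comm, hGeq t _ (hker t η), hGeq t _ (hker t η'), map_sub,
        sub_sub_sub_comm]
    rwa [h2, map_sub] at h1
  · simp only [hgraph]
    set η := G τ (u - Q τ u) with hη
    have hG0 : 0 < Γ (0, 1) := hΓ.pos (by simp)
    have hz := h.zero_mem_stableSet τ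
    have h1 := h.movingNorm_sub_le_of_slopeBound hslope (h.mapsTo_stableSet ht (hmem τ u))
      (h.mapsTo_stableSet ht hz)
    have h2 := h.stableNorm_sub_le_of_slopeBound hslope hκσ (hmem τ u) hz ht
    rw [h.map_zero ht, sub_zero] at h1 h2
    rw [sub_zero] at h2
    have hq0 : 0 ≤ stableNorm L γ τ (η - Q τ η) :=
      HasExponentialSplitting.stableNorm_nonneg _ _
    -- Dropping the unstable component produces the denominator `Γ(0,1)`; the orbit is compared with
    -- the zero orbit.
    have h3 : stableNorm L γ τ (η - Q τ η) * Γ (0, 1) ≤ movingNorm Γ L Q γ ρ τ η := by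
      rw [← IsAdmissibleNorm.map_mul hq0, mul_zero, mul_one]
      exact hΓ.mono le_rfl hq0 (HasExponentialSplitting.unstableNorm_nonneg _ _) le_rfl
    refine (h1.trans (mul_le_mul_of_nonneg_left h2 (apply_nonneg Γ _))).trans ?_
    rw [← le_div_iff₀ hG0] at h3
    have h4 : 0 ≤ Γ (κ, 1) := apply_nonneg Γ _
    calc _ ≤ Γ (κ, 1) * (movingNorm Γ L Q γ ρ τ η / Γ (0, 1) *
          Real.exp (-(γ - L₂ * Γ (κ, 1)) * (t - τ))) := by gcongr
      _ = _ := by ring
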